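/- Let $w>1$ be real. For integers $n\ge 1$ put $b=(w-1)n$ and let $\langle\cdot\rangle$ denote the average over $(0,\infty)^n$ with respect to the joint probability density of the Laguerre unitary ensemble ($\beta=2$), $$p(x_1,\dots,x_n)=\frac1C\prod_{j=1}^n x_j^{\,b}e^{-x_j}\prod_{1\le i<j\le n}|x_j-x_i|^2 ,$$ where $C$ is the normalization constant. For integers $k\ge1$ let $$M_{\mathrm L_b}^{(2)}(-k,n)=\big\langle x_1^{-k}+\dots+x_n^{-k}\big\rangle .$$ (For $w=2$, so that $b=n$, these are $n^{-k}$ times the moments $\langle\tau_1^k+\dots+\tau_n^k\rangle$ of the proper delay times $\tau_j=n/x_j$ with Heisenberg time $n$.) The density is normalizable and this average is finite whenever $k<n(w-1)+1$, and for every $k\ge 1$ there is an asymptotic expansion $$n^{k-1}M_{\mathrm L_b}^{(2)}(-k,n)\sim\sum_{p=0}^\infty \mathcal D^{(2)}_{k,p}(w)\,n^{-p},\qquad n\to\infty,$$ whose coefficients do not depend on $n$. Let $$P_m^{(\alpha,\gamma)}(x)=\sum_{j=0}^m\binom{m+\alpha}{m-j}\binom{m+\gamma}{j}\Big(\frac{x-1}2\Big)^j\Big(\frac{x+1}2\Big)^{m-j}$$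 be the Jacobi polynomials, with $P^{(\alpha,\gamma)}_{-1}=0$. Then for every $k\ge1$ $$\mathcal D^{(2)}_{k,2}(w)=\frac{(k+1)(k+2)\,w}{12\,(w-1)^{k+3}}\,P^{(2,2)}_{k-2}\!\left(\frac{w+1}{w-1}\right)$$ (in particular $\mathcal D^{(2)}_{1,2}(w)=0$), and for all complex $s$ in a neighbourhood of $0$ the series below converges and $$\sum_{k=1}^\infty \mathcal D^{(2)}_{k,2}(w)\,s^k=\frac{w s^2}{\bigl(s^2-2(w+1)s+(w-1)^2\bigr)^{5/2}},$$ where the power is the principal branch. -/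

import Mathlib

open MeasureTheory Filter Asymptotics

noncomputable section

/-- The open orthant `(0, ∞)^n` on which the Laguerre density lives. -/
def posOrthant (n : ℕ) : Set (Fin n → ℝ) :=
  Set.univ.pi fun _ => Set.Ioi 0

/-- The unnormalised joint density of the Laguerre `β`-ensemble with parameter `b`:
`∏ⱼ xⱼ^{β/2 (b+1) - 1} e^{-β xⱼ / 2} ∏_{i<j} |xⱼ - xᵢ|^β`. -/
def laguerreWeight (β b : ℝ) (n : ℕ) (x : Fin n → ℝ) : ℝ :=
  (∏ j, x j ^ (β / 2 * (b + 1) - 1) * Real.exp (-(β * x j / 2))) *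
    ∏ i, ∏ j ∈ Finset.Ioi i, |x j - x i| ^ β

/-- The normalisation constant of the Laguerre ensemble. -/
def laguerreNorm (β b : ℝ) (n : ℕ) : ℝ :=
  ∫ x in posOrthant n, laguerreWeight β b n x

/-- The integrand of the `k`-th negative moment:
`(x₁^{-k} + ⋯ + xₙ^{-k})` times the unnormalised density. -/
def negMomentIntegrand (β b : ℝ) (k n : ℕ) (x : Fin n → ℝ) : ℝ :=
  (∑ j, (x j ^ k)⁻¹) * laguerreWeight β b n x

/-- The negative moment `⟨x₁^{-k} + ⋯ + xₙ^{-k}⟩` of the Laguerre ensemble. -/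
def laguerreNegMoment (β b : ℝ) (k n : ℕ) : ℝ :=
  (∫ x in posOrthant n, negMomentIntegrand β b k n x) / laguerreNorm β b n

/-- The scaling of the Laguerre parameter with `n`: `b = n (w - 1) + 2 / β - 1`. -/
def delayParam (β w : ℝ) (n : ℕ) : ℝ := n * (w - 1) + 2 / β - 1

/-- The scaled moments `n^{k-1} ⟨x₁^{-k} + ⋯ + xₙ^{-k}⟩` (for `1 ≤ k`),
with `b = n (w - 1) + 2 / β - 1`. -/
def scaledDelayMoment (β w : ℝ) (k n : ℕ) : ℝ :=
  (n : ℝ) ^ (k - 1) * laguerreNegMoment β (delayParam β w n) k n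

/-- Asymptotic expansion in the sense of Poincaré: `f n ∼ ∑ₚ c p * n^{-p}` as `n → ∞`. -/
def HasAsymptoticExpansion (f : ℕ → ℝ) (c : ℕ → ℝ) : Prop :=
  ∀ N : ℕ, (fun n : ℕ => f n - ∑ p ∈ Finset.range N, c p / (n : ℝ) ^ p)
    =O[atTop] fun n : ℕ => 1 / (n : ℝ) ^ N

/-- The Jacobi polynomial `P_m^{(α, γ)}(x)` of degree `m`
(for natural parameters), by its explicit formula. -/
def jacobiP (α γ m : ℕ) (x : ℝ) : ℝ :=
  ∑ j ∈ Finset.range (m + 1), ((m + α).choose (m - j) : ℝ) * ((m + γ).choose j : ℝ) *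
    ((x - 1) / 2) ^ j * ((x + 1) / 2) ^ (m - j)

end

/-! For β = 2 the squared Vandermonde is the squared determinant of the monic Laguerre polynomials
π_m. Expanding it and using orthogonality reduces the average of ∑ x_j^(-k) to Q(t) = ∑_{m<n} ∫ x^t
e^(-x) π_m² / h_m at t = b - k (`laguerreNegMoment_two`).

Integration by parts against x^t e^(-x), with the first-order differential system for π_n and
π_{n+1}, collapses Q(t) to one mixed moment of π_n π_{n+1} (`laguerreMoment_succ`) and yields a
three-term recurrence in t (`laguerreMoment_recurrence`). With b = n(w - 1), the scaled moment is
exactly R_k(1/n²) for large n, where R_k = `delayRatio w k` is rational and analytic at 0. So the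
expansion contains only even powers of 1/n, and its coefficient at n^(-2) is R_k'(0).

At y = 0 the recurrence for R_k(0) is solved by Gegenbauer polynomials of parameter 3/2.
Differentiating it gives an inhomogeneous recurrence for R_k'(0), solved by those of parameter 5/2
(`delayRatio_zero_and_hasDerivAt`). These are multiples of P^(2,2) because the three-term
recurrences agree, and they are the Taylor coefficients of q^(-5/2) because this function satisfies
q h' + (5/2) q' h = 0. -/

noncomputable section

open Polynomial in
/-- The linear functional `p ↦ ∑ⱼ pⱼ Γ(t + 1 + j)`, that is `p ↦ ∫₀^∞ x^t e^{-x} p(x) dx`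
when `-1 < t`. -/
def gammaFunctional (t : ℝ) : ℝ[X] →ₗ[ℝ] ℝ :=
  Polynomial.lsum fun j => Real.Gamma (t + 1 + j) • LinearMap.id

open Polynomial in
/-- The monic Laguerre polynomials, by their three-term recurrence. -/
def monicLaguerre (b : ℝ) : ℕ → ℝ[X]
  | 0 => 1
  | 1 => X - C (b + 1)
  | n + 2 => (X - C (2 * (n + 1 : ℝ) + 1 + b)) * monicLaguerre b (n + 1) -
      C ((n + 1 : ℝ) * (n + 1 + b)) * monicLaguerre b n

/-- The squared norms `∫₀^∞ x^b e^{-x} π_n(x)² dx` of the monic Laguerre polynomials. -/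
def laguerreSqNorm (b : ℝ) : ℕ → ℝ
  | 0 => Real.Gamma (b + 1)
  | n + 1 => (n + 1) * (n + 1 + b) * laguerreSqNorm b n

/-! ### The moment functional of x^t e^(-x) on polynomials -/

section GammaFunctional

open Polynomial

theorem gammaFunctional_monomial (t : ℝ) (j : ℕ) (a : ℝ) :
    gammaFunctional t (monomial j a) = Real.Gamma (t + 1 + j) * a := by
  simp [gammaFunctional, Polynomial.lsum_apply, Polynomial.sum_monomial_index]

theorem gammaFunctional_C_mul (t a : ℝ) (p : ℝ[X]) :
    gammaFunctional t (C a * p) = a * gammaFunctional t p := by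
  rw [← smul_eq_C_mul, map_smul, smul_eq_mul]

theorem gammaFunctional_X_mul (t : ℝ) (p : ℝ[X]) :
    gammaFunctional t (X * p) = gammaFunctional (t + 1) p := by
  induction p using Polynomial.induction_on' with
  | add p q hp hq => rw [mul_add, map_add, map_add, hp, hq]
  | monomial j a =>
    rw [X_mul_monomial, gammaFunctional_monomial, gammaFunctional_monomial]
    push_cast
    ring_nf

/-- Integration by parts against `x^t e^{-x}`. -/
theorem gammaFunctional_ibp {t : ℝ} (ht : -1 < t) (p : ℝ[X]) :
    gammaFunctional t (X * derivative p) + (t + 1) * gammaFunctional t p =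
      gammaFunctional (t + 1) p := by
  induction p using Polynomial.induction_on' with
  | add p q hp hq =>
    rw [derivative_add, mul_add, map_add, map_add, map_add, ← hp, ← hq]
    ring
  | monomial j a =>
    have hj : t + 1 + j ≠ 0 := by have := j.cast_nonneg (α := ℝ); linarith
    have h := Real.Gamma_add_one hj
    have e : X * derivative (monomial j a) = monomial j ((j : ℝ) * a) := by
      rw [derivative_monomial]
      rcases j with _ | j
      · simp
      · rw [X_mul_monomial]; simp [mul_comm]
    rw [e, gammaFunctional_monomial, gammaFunctional_monomial, gammaFunctional_monomial,
      show t + 1 + 1 + (j : ℝ) = t + 1 + j + 1 by ring, h]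
    ring

end GammaFunctional

/-! ### Monic Laguerre polynomials: differential system, moment identities, orthogonality -/

section MonicLaguerre

open Polynomial

theorem monicLaguerre_succ_succ (b : ℝ) (n : ℕ) :
    monicLaguerre b (n + 2) = (X - C (2 * (n + 1 : ℝ) + 1 + b)) * monicLaguerre b (n + 1) -
      C ((n + 1 : ℝ) * (n + 1 + b)) * monicLaguerre b n := rfl

theorem monicLaguerre_monic_natDegree (b : ℝ) (n : ℕ) :
    ((monicLaguerre b n).Monic ∧ (monicLaguerre b n).natDegree = n) ∧
    ((monicLaguerre b (n + 1)).Monic ∧ (monicLaguerre b (n + 1)).natDegree = n + 1) := by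
  induction n with
  | zero =>
    exact ⟨⟨monic_one, natDegree_one⟩, monic_X_sub_C _, natDegree_X_sub_C _⟩
  | succ n ih =>
    refine ⟨ih.2, ?_⟩
    obtain ⟨⟨h0, d0⟩, h1, d1⟩ := ih
    have hm : ((X - C (2 * (n + 1 : ℝ) + 1 + b)) * monicLaguerre b (n + 1)).Monic :=
      (monic_X_sub_C _).mul h1
    have hd : ((X - C (2 * (n + 1 : ℝ) + 1 + b)) * monicLaguerre b (n + 1)).natDegree = n + 2 := by
      rw [(monic_X_sub_C _).natDegree_mul h1, natDegree_X_sub_C, d1]; ring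
    have hlt : (C ((n + 1 : ℝ) * (n + 1 + b)) * monicLaguerre b n).natDegree <
        ((X - C (2 * (n + 1 : ℝ) + 1 + b)) * monicLaguerre b (n + 1)).natDegree := by
      refine (natDegree_C_mul_le _ _).trans_lt ?_
      rw [hd, d0]; omega
    rw [show n + 1 + 1 = n + 2 from rfl, monicLaguerre_succ_succ]
    refine ⟨hm.sub_of_left (degree_lt_degree hlt), ?_⟩
    rw [natDegree_sub_eq_left_of_natDegree_lt hlt, hd]

theorem monicLaguerre_monic (b : ℝ) (n : ℕ) : (monicLaguerre b n).Monic :=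
  (monicLaguerre_monic_natDegree b n).1.1

theorem monicLaguerre_natDegree (b : ℝ) (n : ℕ) : (monicLaguerre b n).natDegree = n :=
  (monicLaguerre_monic_natDegree b n).1.2

/-- The first-order differential system satisfied by two consecutive Laguerre polynomials. -/
theorem X_mul_derivative_monicLaguerre (b : ℝ) (n : ℕ) :
    X * derivative (monicLaguerre b (n + 1)) =
      C (n + 1 : ℝ) * monicLaguerre b (n + 1) +
        C ((n + 1 : ℝ) * (n + 1 + b)) * monicLaguerre b n ∧
    X * derivative (monicLaguerre b n) =
      -monicLaguerre b (n + 1) + (X - C (n + 1 + b)) * monicLaguerre b n := by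
  induction n with
  | zero =>
    simp only [monicLaguerre, derivative_sub, derivative_X, derivative_C, derivative_one]
    simp only [C_add, C_mul, C_1, Nat.cast_zero, C_0]
    constructor <;> ring
  | succ n ih =>
    obtain ⟨h1, h0⟩ := ih
    constructor
    · rw [show n + 1 + 1 = n + 2 from rfl, monicLaguerre_succ_succ]
      simp only [derivative_sub, derivative_mul, derivative_X, derivative_C]
      have : X * ((1 - 0) * monicLaguerre b (n + 1) +
          (X - C (2 * (n + 1 : ℝ) + 1 + b)) * derivative (monicLaguerre b (n + 1)) -
          (0 * monicLaguerre b n + C ((n + 1 : ℝ) * (n + 1 + b)) * derivative (monicLaguerre b n)))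
          = X * monicLaguerre b (n + 1) +
          (X - C (2 * (n + 1 : ℝ) + 1 + b)) * (X * derivative (monicLaguerre b (n + 1))) -
          C ((n + 1 : ℝ) * (n + 1 + b)) * (X * derivative (monicLaguerre b n)) := by ring
      rw [this, h1, h0]
      simp only [C_add, C_mul, C_1, Nat.cast_add, Nat.cast_one]
      rw [show (C 2 : ℝ[X]) = 2 from rfl]
      ring
    · rw [h1, show n + 1 + 1 = n + 2 from rfl, monicLaguerre_succ_succ]
      simp only [C_add, C_mul, C_1, Nat.cast_add, Nat.cast_one]
      rw [show (C 2 : ℝ[X]) = 2 from rfl]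
      ring

/-- The moments of products of consecutive Laguerre polynomials at exponents `t` and `t + 1`. -/
theorem gammaFunctional_monicLaguerre_sq_succ {b t : ℝ} (ht : -1 < t) (n : ℕ) :
    gammaFunctional (t + 1) (monicLaguerre b (n + 1) ^ 2) =
      (t + 1 + 2 * (n + 1)) * gammaFunctional t (monicLaguerre b (n + 1) ^ 2) +
      2 * ((n + 1) * (n + 1 + b)) *
        gammaFunctional t (monicLaguerre b (n + 1) * monicLaguerre b n) := by
  obtain ⟨h1, h0⟩ := X_mul_derivative_monicLaguerre b n
  have h := gammaFunctional_ibp ht (monicLaguerre b (n + 1) ^ 2)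
  have e : X * derivative (monicLaguerre b (n + 1) ^ 2) =
      C (2 * (n + 1 : ℝ)) * monicLaguerre b (n + 1) ^ 2 +
      C (2 * ((n + 1 : ℝ) * (n + 1 + b))) * (monicLaguerre b (n + 1) * monicLaguerre b n) := by
    rw [derivative_sq, show X * (C 2 * monicLaguerre b (n + 1) * derivative (monicLaguerre b (n + 1)))
      = C 2 * monicLaguerre b (n + 1) * (X * derivative (monicLaguerre b (n + 1))) by ring, h1]
    simp only [C_mul]
    ring
  rw [e, map_add, gammaFunctional_C_mul, gammaFunctional_C_mul] at h
  linear_combination -h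

/-- In X (π_{n+1} π_n)' the term X π_{n+1} π_n cancels the right side of the integration by parts,
so all moments stay at exponent t. The cases t = b and t = b - 1 give the norms and the first
negative moment. -/
theorem gammaFunctional_monicLaguerre_mul {b t : ℝ} (ht : -1 < t) (n : ℕ) :
    (t + 1 - b) * gammaFunctional t (monicLaguerre b (n + 1) * monicLaguerre b n) +
      (n + 1) * (n + 1 + b) * gammaFunctional t (monicLaguerre b n ^ 2) =
      gammaFunctional t (monicLaguerre b (n + 1) ^ 2) := by
  obtain ⟨h1, h0⟩ := X_mul_derivative_monicLaguerre b n
  have h := gammaFunctional_ibp ht (monicLaguerre b (n + 1) * monicLaguerre b n)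
  have e : X * derivative (monicLaguerre b (n + 1) * monicLaguerre b n) =
      X * (monicLaguerre b (n + 1) * monicLaguerre b n) +
      C (-b) * (monicLaguerre b (n + 1) * monicLaguerre b n) +
      C ((n + 1 : ℝ) * (n + 1 + b)) * monicLaguerre b n ^ 2 - monicLaguerre b (n + 1) ^ 2 := by
    rw [derivative_mul, mul_add, ← mul_assoc, h1, mul_left_comm, h0]
    simp only [C_mul, C_add, C_neg]
    ring
  rw [e, map_sub, map_add, map_add, gammaFunctional_C_mul, gammaFunctional_C_mul,
    gammaFunctional_X_mul] at h
  linear_combination h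

theorem gammaFunctional_monicLaguerre_sq_succ' {b t : ℝ} (ht : -1 < t) (n : ℕ) :
    gammaFunctional (t + 1) (monicLaguerre b n ^ 2) =
      2 * gammaFunctional t (monicLaguerre b (n + 1) * monicLaguerre b n) +
      (2 * b + 2 * (n + 1) - t - 1) * gammaFunctional t (monicLaguerre b n ^ 2) := by
  obtain ⟨h1, h0⟩ := X_mul_derivative_monicLaguerre b n
  have h := gammaFunctional_ibp ht (monicLaguerre b n ^ 2)
  have e : X * derivative (monicLaguerre b n ^ 2) =
      C (-2) * (monicLaguerre b (n + 1) * monicLaguerre b n) +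
      C (-2 * (n + 1 + b)) * monicLaguerre b n ^ 2 + C 2 * (X * monicLaguerre b n ^ 2) := by
    rw [derivative_sq, show X * (C 2 * monicLaguerre b n * derivative (monicLaguerre b n))
      = C 2 * monicLaguerre b n * (X * derivative (monicLaguerre b n)) by ring, h0]
    simp only [C_mul, C_neg]
    ring
  rw [e, map_add, map_add, gammaFunctional_C_mul, gammaFunctional_C_mul, gammaFunctional_C_mul,
    gammaFunctional_X_mul] at h
  linear_combination h

/-- The factor j - n vanishes at n = j, and the zero then propagates to every larger degree: this is
the source of orthogonality. -/
theorem gammaFunctional_X_pow_mul_monicLaguerre_succ {b : ℝ} (hb : -1 < b) (j n : ℕ) :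
    gammaFunctional b (X ^ j * monicLaguerre b (n + 1)) =
      (j - n) * gammaFunctional b (X ^ j * monicLaguerre b n) := by
  have h := gammaFunctional_ibp hb (X ^ j * monicLaguerre b n)
  have e : X * derivative (X ^ j * monicLaguerre b n) =
      C (j - n - 1 - b) * (X ^ j * monicLaguerre b n) + X * (X ^ j * monicLaguerre b n)
        - X ^ j * monicLaguerre b (n + 1) := by
    have e1 : X * derivative (X ^ j : ℝ[X]) = C (j : ℝ) * X ^ j := by
      rcases j with _ | j
      · simp
      · rw [derivative_X_pow_succ]; simp only [C_add, C_1, Nat.cast_add, Nat.cast_one]; ring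
    rw [derivative_mul, mul_add, ← mul_assoc, e1, mul_left_comm,
      (X_mul_derivative_monicLaguerre b n).2]
    simp only [C_sub, C_add, C_1]
    ring
  rw [e, map_sub, map_add, gammaFunctional_C_mul, gammaFunctional_X_mul] at h
  linear_combination -h

theorem gammaFunctional_X_pow_mul_monicLaguerre {b : ℝ} (hb : -1 < b) {j n : ℕ} (h : j < n) :
    gammaFunctional b (X ^ j * monicLaguerre b n) = 0 := by
  induction n, h using Nat.le_induction with
  | base => rw [gammaFunctional_X_pow_mul_monicLaguerre_succ hb, sub_self, zero_mul]
  | succ n _ ih => rw [gammaFunctional_X_pow_mul_monicLaguerre_succ hb, ih, mul_zero]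

theorem gammaFunctional_mul_monicLaguerre_of_natDegree_lt {b : ℝ} (hb : -1 < b) {n : ℕ}
    {p : ℝ[X]} (h : p.natDegree < n) : gammaFunctional b (p * monicLaguerre b n) = 0 := by
  rw [p.as_sum_range_C_mul_X_pow, Finset.sum_mul, map_sum]
  refine Finset.sum_eq_zero fun j hj => ?_
  rw [mul_assoc, gammaFunctional_C_mul, gammaFunctional_X_pow_mul_monicLaguerre hb
    (by rw [Finset.mem_range] at hj; omega), mul_zero]

theorem gammaFunctional_monicLaguerre_orthogonal {b : ℝ} (hb : -1 < b) {m n : ℕ} (h : m ≠ n) :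
    gammaFunctional b (monicLaguerre b m * monicLaguerre b n) = 0 := by
  rcases h.lt_or_gt with h | h
  · exact gammaFunctional_mul_monicLaguerre_of_natDegree_lt hb (by rwa [monicLaguerre_natDegree])
  · rw [mul_comm]
    exact gammaFunctional_mul_monicLaguerre_of_natDegree_lt hb (by rwa [monicLaguerre_natDegree])

/-- At t = b the mixed moment vanishes by orthogonality, which leaves the recursion of the norms. -/
theorem gammaFunctional_monicLaguerre_sq {b : ℝ} (hb : -1 < b) (n : ℕ) :
    gammaFunctional b (monicLaguerre b n ^ 2) = laguerreSqNorm b n := by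
  induction n with
  | zero =>
    have := gammaFunctional_monomial b 0 1
    simpa [monicLaguerre, laguerreSqNorm] using this
  | succ n ih =>
    rw [← gammaFunctional_monicLaguerre_mul hb, ih,
      gammaFunctional_monicLaguerre_orthogonal hb (Nat.succ_ne_self n), laguerreSqNorm]
    ring

theorem laguerreSqNorm_pos {b : ℝ} (hb : -1 < b) (n : ℕ) : 0 < laguerreSqNorm b n := by
  induction n with
  | zero => exact Real.Gamma_pos_of_pos (by linarith)
  | succ n ih =>
    have : 0 < (n : ℝ) + 1 + b := by have := n.cast_nonneg (α := ℝ); linarith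
    rw [laguerreSqNorm]; positivity

end MonicLaguerre

/-! ### The functional as an integral over the half-line -/

section GammaIntegrals

open Polynomial

theorem integrableOn_rpow_mul_exp_mul_polynomial {t : ℝ} (ht : -1 < t) (p : ℝ[X]) :
    IntegrableOn (fun x => p.eval x * (x ^ t * Real.exp (-x))) (Set.Ioi 0) ∧
      ∫ x in Set.Ioi 0, p.eval x * (x ^ t * Real.exp (-x)) = gammaFunctional t p := by
  induction p using Polynomial.induction_on' with
  | add p q hp hq =>
    simp only [eval_add, add_mul]
    exact ⟨hp.1.add hq.1, by rw [integral_add hp.1 hq.1, hp.2, hq.2, map_add]⟩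
  | monomial j a =>
    have hj : 0 < t + 1 + j := by have := j.cast_nonneg (α := ℝ); linarith
    have e : Set.EqOn (fun x : ℝ => a * (Real.exp (-x) * x ^ (t + 1 + j - 1)))
        (fun x => (monomial j a).eval x * (x ^ t * Real.exp (-x))) (Set.Ioi 0) := by
      intro x hx
      have hx : 0 < x := hx
      simp only [eval_monomial]
      rw [show t + 1 + j - 1 = t + j by ring, Real.rpow_add_natCast hx.ne']
      ring
    constructor
    · exact IntegrableOn.congr_fun ((Real.GammaIntegral_convergent hj).const_mul a) e
        measurableSet_Ioi
    · rw [← setIntegral_congr_fun measurableSet_Ioi e, integral_const_mul,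
        ← Real.Gamma_eq_integral hj, gammaFunctional_monomial, mul_comm]

end GammaIntegrals

/-! ### Integrals of squared determinants -/

section Determinant

variable {n : ℕ}

theorem prod_mul_det_sq_eq_sum (φ ψ : Fin n → ℝ → ℝ) (x : Fin n → ℝ) :
    (∏ i, ψ i (x i)) * (Matrix.of fun i j => φ j (x i)).det ^ 2 =
      ∑ σ : Equiv.Perm (Fin n), ∑ τ : Equiv.Perm (Fin n),
        ((Equiv.Perm.sign σ : ℤ) : ℝ) * ((Equiv.Perm.sign τ : ℤ) : ℝ) *
          ∏ i, (φ (σ i) (x i) * φ (τ i) (x i) * ψ i (x i)) := by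
  rw [← Matrix.det_transpose, Matrix.det_apply', sq, Finset.sum_mul_sum, Finset.mul_sum]
  refine Finset.sum_congr rfl fun σ _ => ?_
  rw [Finset.mul_sum]
  refine Finset.sum_congr rfl fun τ _ => ?_
  simp only [Finset.prod_mul_distrib, Matrix.transpose_apply, Matrix.of_apply]
  ring

/-- Andréief's expansion of the integral of a squared determinant against a product weight. -/
theorem integral_prod_mul_det_sq {μ : Measure ℝ} [SigmaFinite μ] {φ ψ : Fin n → ℝ → ℝ}
    (h : ∀ i j l, Integrable (fun x => φ i x * φ j x * ψ l x) μ) :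
    Integrable (fun x : Fin n → ℝ => (∏ i, ψ i (x i)) * (Matrix.of fun i j => φ j (x i)).det ^ 2)
      (Measure.pi fun _ => μ) ∧
    ∫ x : Fin n → ℝ, (∏ i, ψ i (x i)) * (Matrix.of fun i j => φ j (x i)).det ^ 2
      ∂(Measure.pi fun _ => μ) =
      ∑ σ : Equiv.Perm (Fin n), ∑ τ : Equiv.Perm (Fin n),
        ((Equiv.Perm.sign σ : ℤ) : ℝ) * ((Equiv.Perm.sign τ : ℤ) : ℝ) *
          ∏ i, ∫ x, φ (σ i) x * φ (τ i) x * ψ i x ∂μ := by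
  simp only [prod_mul_det_sq_eq_sum]
  have hi : ∀ σ τ : Equiv.Perm (Fin n), Integrable (fun x : Fin n → ℝ =>
      ((Equiv.Perm.sign σ : ℤ) : ℝ) * ((Equiv.Perm.sign τ : ℤ) : ℝ) *
          ∏ i, (φ (σ i) (x i) * φ (τ i) (x i) * ψ i (x i))) (Measure.pi fun _ => μ) :=
    fun σ τ => (Integrable.fintype_prod fun i => h (σ i) (τ i) i).const_mul _
  constructor
  · exact integrable_finsetSum _ fun σ _ => integrable_finsetSum _ fun τ _ => hi σ τ
  · rw [integral_finsetSum _ fun σ _ => integrable_finsetSum _ fun τ _ => hi σ τ]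
    refine Finset.sum_congr rfl fun σ _ => ?_
    rw [integral_finsetSum _ fun τ _ => hi σ τ]
    refine Finset.sum_congr rfl fun τ _ => ?_
    rw [integral_const_mul,
      integral_fintype_prod_eq_prod fun i x => φ (σ i) x * φ (τ i) x * ψ i x]

/-- Injectivity forces the one remaining value. In the determinant expansion one variable carries a
modified exponent, so orthogonality only gives agreement of the two permutations at the others. -/
theorem perm_eq_of_forall_ne {α : Type*} {σ τ : Equiv.Perm α} (l : α)
    (h : ∀ i, i ≠ l → σ i = τ i) : σ = τ := by
  ext i
  by_cases hi : i = l
  · subst hi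
    by_contra hne
    have hm : τ.symm (σ i) ≠ i := fun hm => hne (by rw [← hm, Equiv.apply_symm_apply, hm])
    have := h _ hm
    rw [Equiv.apply_symm_apply] at this
    exact hm (σ.injective this)
  · exact h i hi

end Determinant

/-! ### Reduction of the ensemble averages to one-variable moments -/

section LaguerreEnsemble

/-- The Laguerre weight (`β = 2`) in which the exponent of the `l`-th variable is `t`. -/
def laguerreWeightUpdate (b : ℝ) {n : ℕ} (l : Fin n) (t : ℝ) (x : Fin n → ℝ) : ℝ :=
  (∏ i, x i ^ (Function.update (fun _ => b) l t i : ℝ) * Real.exp (-x i)) *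
    (Matrix.of fun i j : Fin n => (monicLaguerre b j).eval (x i)).det ^ 2

/-- Column operations replace the powers in the Vandermonde determinant by any monic polynomials of
the same degrees. -/
theorem prod_abs_sub_rpow_two (b : ℝ) {n : ℕ} (x : Fin n → ℝ) :
    ∏ i, ∏ j ∈ Finset.Ioi i, |x j - x i| ^ (2 : ℝ) =
      (Matrix.of fun i j : Fin n => (monicLaguerre b j).eval (x i)).det ^ 2 := by
  rw [← Matrix.det_eval_matrixOfPolynomials_eq_det_vandermonde x
    (fun j : Fin n => monicLaguerre b j) (fun i => monicLaguerre_natDegree b i)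
    (fun i => monicLaguerre_monic b i), Matrix.det_vandermonde, ← Finset.prod_pow]
  refine Finset.prod_congr rfl fun i _ => ?_
  rw [← Finset.prod_pow]
  refine Finset.prod_congr rfl fun j _ => ?_
  rw [Real.rpow_two, sq_abs]

theorem laguerreWeight_eq_update (b : ℝ) {n : ℕ} (l : Fin n) :
    laguerreWeight 2 b n = laguerreWeightUpdate b l b := by
  funext x
  rw [laguerreWeight, laguerreWeightUpdate, prod_abs_sub_rpow_two b]
  congr 1
  refine Finset.prod_congr rfl fun i _ => ?_
  rw [Function.update_eq_self_iff.2 rfl, show 2 / 2 * (b + 1) - 1 = b by ring,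
    show 2 * x i / 2 = x i by ring]

theorem inv_pow_mul_laguerreWeight (b : ℝ) (k : ℕ) {n : ℕ} (l : Fin n) {x : Fin n → ℝ}
    (hx : x ∈ posOrthant n) :
    (x l ^ k)⁻¹ * laguerreWeight 2 b n x = laguerreWeightUpdate b l (b - k) x := by
  have hl : 0 < x l := hx l (Set.mem_univ l)
  rw [laguerreWeight_eq_update b l, laguerreWeightUpdate, laguerreWeightUpdate, ← mul_assoc]
  congr 1
  rw [← Finset.mul_prod_erase _ _ (Finset.mem_univ l), ← Finset.mul_prod_erase _ _ (Finset.mem_univ l),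
    ← mul_assoc]
  congr 1
  · rw [Function.update_self, Function.update_self, Real.rpow_sub_natCast hl.ne']
    ring
  · refine Finset.prod_congr rfl fun i hi => ?_
    rw [Function.update_of_ne (Finset.ne_of_mem_erase hi),
      Function.update_of_ne (Finset.ne_of_mem_erase hi)]

theorem measurableSet_posOrthant (n : ℕ) : MeasurableSet (posOrthant n) :=
  MeasurableSet.univ_pi fun _ => measurableSet_Ioi

theorem volume_restrict_posOrthant (n : ℕ) :
    (volume : Measure (Fin n → ℝ)).restrict (posOrthant n) =
      Measure.pi fun _ => volume.restrict (Set.Ioi 0) := by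
  rw [posOrthant, volume_pi, Measure.restrict_pi_pi]

theorem integral_laguerreWeightUpdate {b t : ℝ} (hb : -1 < b) (ht : -1 < t) {n : ℕ} (l : Fin n) :
    IntegrableOn (laguerreWeightUpdate b l t) (posOrthant n) ∧
    ∫ x in posOrthant n, laguerreWeightUpdate b l t x =
      ∑ σ : Equiv.Perm (Fin n), gammaFunctional t (monicLaguerre b (σ l) ^ 2) /
        laguerreSqNorm b (σ l) * ∏ m : Fin n, laguerreSqNorm b m := by
  have hu : ∀ i : Fin n, -1 < (Function.update (fun _ => b) l t i : ℝ) := by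
    intro i
    by_cases hi : i = l
    · rw [hi, Function.update_self]; exact ht
    · rw [Function.update_of_ne hi]; exact hb
  obtain ⟨h1, h2⟩ := integral_prod_mul_det_sq (μ := volume.restrict (Set.Ioi 0))
    (φ := fun j : Fin n => fun x => (monicLaguerre b j).eval x)
    (ψ := fun i : Fin n => fun x => x ^ (Function.update (fun _ => b) l t i : ℝ) * Real.exp (-x))
    (fun i j m => by
      simp only [← Polynomial.eval_mul]
      exact (integrableOn_rpow_mul_exp_mul_polynomial (hu m) _).1)
  rw [IntegrableOn, volume_restrict_posOrthant]
  refine ⟨h1, ?_⟩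
  refine h2.trans (Finset.sum_congr rfl fun σ _ => ?_)
  simp only [← Polynomial.eval_mul, (integrableOn_rpow_mul_exp_mul_polynomial (hu _) _).2]
  rw [Finset.sum_eq_single σ]
  · rw [← Int.cast_mul, ← Units.val_mul, Int.units_mul_self, Units.val_one, Int.cast_one, one_mul,
      ← Finset.mul_prod_erase _ _ (Finset.mem_univ l), Function.update_self, ← sq,
      ← Equiv.prod_comp σ (fun m : Fin n => laguerreSqNorm b m),
      ← Finset.mul_prod_erase _ _ (Finset.mem_univ l), ← mul_assoc,
      div_mul_cancel₀ _ (laguerreSqNorm_pos hb _).ne']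
    congr 1
    refine Finset.prod_congr rfl fun i hi => ?_
    rw [Function.update_of_ne (Finset.ne_of_mem_erase hi), ← sq,
      gammaFunctional_monicLaguerre_sq hb]
  · intro τ _ hτ
    -- Off-diagonal terms must be killed at a variable other than `l`, where the exponent is still b
    -- and orthogonality applies.
    have : ∃ i, i ≠ l ∧ σ i ≠ τ i := by
      by_contra! hc
      exact hτ (perm_eq_of_forall_ne l hc).symm
    obtain ⟨i, hi, hne⟩ := this
    rw [Finset.prod_eq_zero (Finset.mem_univ i), mul_zero]
    rw [Function.update_of_ne hi]
    exact gammaFunctional_monicLaguerre_orthogonal hb (fun hc => hne (Fin.ext hc))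
  · exact fun hσ => absurd (Finset.mem_univ σ) hσ

theorem laguerreNorm_two {b : ℝ} (hb : -1 < b) {n : ℕ} (hn : 0 < n) :
    IntegrableOn (laguerreWeight 2 b n) (posOrthant n) ∧
    laguerreNorm 2 b n = n.factorial * ∏ m : Fin n, laguerreSqNorm b m := by
  have h := integral_laguerreWeightUpdate hb hb (⟨0, hn⟩ : Fin n)
  rw [← laguerreWeight_eq_update] at h
  refine ⟨h.1, h.2.trans ?_⟩
  simp only [gammaFunctional_monicLaguerre_sq hb, div_self (laguerreSqNorm_pos hb _).ne', one_mul,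
    Finset.sum_const, Finset.card_univ, Fintype.card_perm, Fintype.card_fin, nsmul_eq_mul]

theorem laguerreNorm_two_pos {b : ℝ} (hb : -1 < b) {n : ℕ} (hn : 0 < n) :
    0 < laguerreNorm 2 b n := by
  rw [(laguerreNorm_two hb hn).2]
  exact mul_pos (by positivity) (Finset.prod_pos fun m _ => laguerreSqNorm_pos hb m)

/-- The `β = 2` moment `∑_{m < n} ∫ x^t e^{-x} π_m(x)² dx / h_m`, where `t` is the
total exponent. -/
def laguerreMoment (b t : ℝ) (n : ℕ) : ℝ :=
  ∑ m ∈ Finset.range n, gammaFunctional t (monicLaguerre b m ^ 2) / laguerreSqNorm b m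

/-- For fixed σ, summing over l makes σ l run through all indices, so each of the n! permutations
contributes the same amount. The prefactor is exactly the normalisation constant. -/
theorem integral_negMomentIntegrand {b : ℝ} {k : ℕ} (hb : (k : ℝ) - 1 < b) (n : ℕ) :
    IntegrableOn (negMomentIntegrand 2 b k n) (posOrthant n) ∧
    ∫ x in posOrthant n, negMomentIntegrand 2 b k n x =
      n.factorial * (∏ m : Fin n, laguerreSqNorm b m) * laguerreMoment b (b - k) n := by
  have hb' : -1 < b := by have := k.cast_nonneg (α := ℝ); linarith
  have h := fun l : Fin n =>
    integral_laguerreWeightUpdate hb' (by linarith : -1 < b - (k : ℝ)) l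
  have e : Set.EqOn (fun x => ∑ l : Fin n, laguerreWeightUpdate b l (b - k) x)
      (negMomentIntegrand 2 b k n) (posOrthant n) := by
    intro x hx
    simp only [negMomentIntegrand, Finset.sum_mul, inv_pow_mul_laguerreWeight b k _ hx]
  refine ⟨IntegrableOn.congr_fun (integrable_finsetSum _ fun l _ => (h l).1) e
    (measurableSet_posOrthant n), ?_⟩
  rw [← setIntegral_congr_fun (measurableSet_posOrthant n) e,
    integral_finsetSum _ fun l _ => (h l).1, Finset.sum_congr rfl fun l _ => (h l).2,
    Finset.sum_comm]
  have e2 : ∀ σ : Equiv.Perm (Fin n), ∑ l : Fin n,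
      gammaFunctional (b - k) (monicLaguerre b (σ l) ^ 2) / laguerreSqNorm b (σ l) *
        ∏ m : Fin n, laguerreSqNorm b m =
      (∏ m : Fin n, laguerreSqNorm b m) * laguerreMoment b (b - k) n := by
    intro σ
    rw [← Finset.sum_mul, Equiv.sum_comp σ (fun m : Fin n =>
      gammaFunctional (b - k) (monicLaguerre b m ^ 2) / laguerreSqNorm b m), laguerreMoment,
      Finset.sum_range, mul_comm]
  rw [Finset.sum_congr rfl fun σ _ => e2 σ, Finset.sum_const, Finset.card_univ, Fintype.card_perm,
    Fintype.card_fin, nsmul_eq_mul, mul_assoc]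

theorem laguerreNegMoment_two {b : ℝ} {k : ℕ} (hb : (k : ℝ) - 1 < b) {n : ℕ} (hn : 0 < n) :
    laguerreNegMoment 2 b k n = laguerreMoment b (b - k) n := by
  have hb' : -1 < b := by have := k.cast_nonneg (α := ℝ); linarith
  have h0 := laguerreNorm_two_pos hb' hn
  rw [laguerreNegMoment, div_eq_iff h0.ne', (integral_negMomentIntegrand hb n).2,
    (laguerreNorm_two hb' hn).2]
  ring

end LaguerreEnsemble

/-! ### Recurrence in the exponent, and the first two negative moments -/

section MomentRecurrence

theorem gammaFunctional_one_succ {t : ℝ} (ht : -1 < t) :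
    gammaFunctional (t + 1) 1 = (t + 1) * gammaFunctional t 1 := by
  have := gammaFunctional_ibp ht 1
  rw [Polynomial.derivative_one, mul_zero, map_zero, zero_add] at this
  exact this.symm

/-- Summation by parts: the moment is a single mixed moment of `π_n` and `π_{n+1}`. -/
theorem laguerreMoment_succ {b t : ℝ} (hb : -1 < b) (ht : -1 < t) (n : ℕ) :
    (t - b) * laguerreMoment b t (n + 1) * laguerreSqNorm b n =
      gammaFunctional t (monicLaguerre b (n + 1) * monicLaguerre b n) := by
  induction n with
  | zero =>
    have h1 := gammaFunctional_monicLaguerre_sq_succ' (b := b) ht 0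
    have h2 := gammaFunctional_one_succ ht
    have h0 := (laguerreSqNorm_pos hb 0).ne'
    have e : monicLaguerre b 0 = 1 := rfl
    rw [laguerreMoment, Finset.sum_range_one, mul_assoc, div_mul_cancel₀ _ h0]
    rw [e, one_pow, Nat.cast_zero] at h1
    rw [e, one_pow]
    linear_combination (h1 - h2) / 2
  | succ n ih =>
    -- Both `h1` and `h2` evaluate the moment of π_{n+1}² at t + 1, one through π_{n+2} and the
    -- other through π_n; their difference is the telescoping step.
    have h1 := gammaFunctional_monicLaguerre_sq_succ' (b := b) ht (n + 1)
    have h2 := gammaFunctional_monicLaguerre_sq_succ (b := b) ht n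
    have h0 := (laguerreSqNorm_pos hb (n + 1)).ne'
    have e : laguerreMoment b t (n + 1 + 1) * laguerreSqNorm b (n + 1) =
        laguerreMoment b t (n + 1) * laguerreSqNorm b (n + 1) +
          gammaFunctional t (monicLaguerre b (n + 1) ^ 2) := by
      rw [laguerreMoment, Finset.sum_range_succ, add_mul, div_mul_cancel₀ _ h0, ← laguerreMoment]
    have e' : laguerreSqNorm b (n + 1) = (n + 1) * (n + 1 + b) * laguerreSqNorm b n := rfl
    rw [mul_assoc, e, e']
    push_cast at h1
    linear_combination ((n : ℝ) + 1) * (n + 1 + b) * ih + (h1 - h2) / 2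

/-- The three-term recurrence for the moments of the Laguerre unitary ensemble. -/
theorem laguerreMoment_recurrence {b s : ℝ} (hb : -1 < b) (hs : -1 < b + s) (h1 : s + 1 ≠ 0)
    (h2 : s + 2 ≠ 0) {n : ℕ} (hn : 0 < n) :
    (s + 3) * laguerreMoment b (b + s + 1 + 1) n =
      (2 * s + 3) * (2 * n + b) * laguerreMoment b (b + s + 1) n +
        s * ((s + 1) ^ 2 - b ^ 2) * laguerreMoment b (b + s) n := by
  obtain ⟨n, rfl⟩ := Nat.exists_eq_succ_of_ne_zero hn.ne'
  have hs1 : -1 < b + s + 1 := by linarith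
  have hs2 : -1 < b + s + 1 + 1 := by linarith
  have b0 := laguerreMoment_succ hb hs n
  have b1 := laguerreMoment_succ hb hs1 n
  have b2 := laguerreMoment_succ hb hs2 n
  have r10 := gammaFunctional_monicLaguerre_sq_succ (b := b) hs n
  have r11 := gammaFunctional_monicLaguerre_sq_succ (b := b) hs1 n
  have r20 := gammaFunctional_monicLaguerre_mul (b := b) hs n
  have r21 := gammaFunctional_monicLaguerre_mul (b := b) hs1 n
  have r22 := gammaFunctional_monicLaguerre_mul (b := b) hs2 n
  have r30 := gammaFunctional_monicLaguerre_sq_succ' (b := b) hs n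
  have r31 := gammaFunctional_monicLaguerre_sq_succ' (b := b) hs1 n
  have h0 := (laguerreSqNorm_pos hb n).ne'
  rw [← b0] at r10 r20 r30
  rw [← b1] at r11 r21 r31
  rw [← b2] at r22
  refine mul_left_cancel₀ (mul_ne_zero (mul_ne_zero h1 h2) h0) ?_
  push_cast
  generalize laguerreMoment b (b + s + 1 + 1) (n + 1) = Q2 at *
  generalize laguerreMoment b (b + s + 1) (n + 1) = Q1 at *
  generalize laguerreMoment b (b + s) (n + 1) = Q0 at *
  generalize gammaFunctional (b + s) (monicLaguerre b n ^ 2) = c0 at *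
  generalize gammaFunctional (b + s + 1) (monicLaguerre b n ^ 2) = c1 at *
  generalize gammaFunctional (b + s + 1 + 1) (monicLaguerre b n ^ 2) = c2 at *
  generalize gammaFunctional (b + s) (monicLaguerre b (n + 1) ^ 2) = a0 at *
  generalize gammaFunctional (b + s + 1) (monicLaguerre b (n + 1) ^ 2) = a1 at *
  generalize gammaFunctional (b + s + 1 + 1) (monicLaguerre b (n + 1) ^ 2) = a2 at *
  generalize laguerreSqNorm b n = h at *
  generalize (n : ℝ) + 1 = N at *
  -- With S_i = a_i + N(N + b) c_i, `e1` and `e2` are one relation at consecutive exponents, and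
  -- `e3` expresses S_1 by S_0 and Q_0. Eliminating S_0 and S_1 introduces the factor (s + 1)(s +
  -- 2), cancelled above.
  have e2 : (s + 3) * ((s + 2) * Q2 * h) =
      (b + 2 * N) * ((s + 2) * ((s + 1) * Q1 * h)) + (s + 2) * (a1 + N * (N + b) * c1) := by
    linear_combination r22 + r11 - N * (N + b) * r31 - (b + 2 * N) * r21
  have e1 : (s + 2) * ((s + 1) * Q1 * h) =
      (b + 2 * N) * ((s + 1) * (s * Q0 * h)) + (s + 1) * (a0 + N * (N + b) * c0) := by
    linear_combination r21 + r10 - N * (N + b) * r30 - (b + 2 * N) * r20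
  have e3 : a1 + N * (N + b) * c1 = (b + 2 * N) * (a0 + N * (N + b) * c0) +
      (s + 1) * ((s + 1) * (s * Q0 * h)) + 4 * (N * (N + b)) * (s * Q0 * h) := by
    linear_combination r10 + N * (N + b) * r30 - (s + 1) * r20
  linear_combination (s + 1) * e2 + (s + 1) * (s + 2) * e3 - (s + 2) * (b + 2 * N) * e1

/-- At t = b - 1 the coefficient t + 1 - b of the mixed moment is zero, so these moments obey the
same recursion as the norms. -/
theorem gammaFunctional_sub_one_monicLaguerre_sq {b : ℝ} (hb : 0 < b) (n : ℕ) :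
    gammaFunctional (b - 1) (monicLaguerre b n ^ 2) = laguerreSqNorm b n / b := by
  induction n with
  | zero =>
    have := gammaFunctional_monomial (b - 1) 0 1
    rw [show b - 1 + 1 + ((0 : ℕ) : ℝ) = b by simp, mul_one] at this
    rw [eq_div_iff hb.ne', laguerreSqNorm, Real.Gamma_add_one hb.ne', mul_comm, ← this]
    simp [monicLaguerre]
  | succ n ih =>
    have h := gammaFunctional_monicLaguerre_mul (b := b) (t := b - 1) (by linarith) n
    rw [ih] at h
    rw [← h, laguerreSqNorm]
    ring

theorem laguerreMoment_sub_one {b : ℝ} (hb : 0 < b) (n : ℕ) :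
    laguerreMoment b (b - 1) n = n / b := by
  have h : ∀ m ∈ Finset.range n,
      gammaFunctional (b - 1) (monicLaguerre b m ^ 2) / laguerreSqNorm b m = 1 / b := by
    intro m _
    have := (laguerreSqNorm_pos (b := b) (by linarith) m).ne'
    rw [gammaFunctional_sub_one_monicLaguerre_sq hb]
    field_simp
  rw [laguerreMoment, Finset.sum_congr rfl h, Finset.sum_const, Finset.card_range, nsmul_eq_mul,
    mul_one_div]

/-- A second initial value, computed directly because the general recurrence excludes s = -2. The
moments at b - 1 are known, which closes the linear system at b - 2. -/
theorem laguerreMoment_sub_two {b : ℝ} (hb : 1 < b) {n : ℕ} (hn : 0 < n) :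
    laguerreMoment b (b - 2) n = n * (n + b) / (b * (b ^ 2 - 1)) := by
  obtain ⟨n, rfl⟩ := Nat.exists_eq_succ_of_ne_zero hn.ne'
  have hb0 : 0 < b := by linarith
  have hs : -1 < b - 2 := by linarith
  have e0 := laguerreMoment_succ (b := b) (by linarith) hs n
  have r1 := gammaFunctional_monicLaguerre_sq_succ (b := b) hs n
  have r2 := gammaFunctional_monicLaguerre_mul (b := b) hs n
  have r3 := gammaFunctional_monicLaguerre_sq_succ' (b := b) hs n
  have h0 := (laguerreSqNorm_pos (b := b) (by linarith) n).ne'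
  rw [show b - 2 + 1 = b - 1 by ring, gammaFunctional_sub_one_monicLaguerre_sq hb0] at r1 r3
  have eh : laguerreSqNorm b (n + 1) = (n + 1) * (n + 1 + b) * laguerreSqNorm b n := rfl
  rw [← e0] at r1 r2 r3
  rw [eh] at r1
  have hb1 : b ^ 2 - 1 ≠ 0 := by nlinarith
  rw [eq_div_iff (mul_ne_zero hb0.ne' hb1)]
  push_cast
  generalize laguerreMoment b (b - 2) (n + 1) = Q at *
  generalize gammaFunctional (b - 2) (monicLaguerre b n ^ 2) = c at *
  generalize gammaFunctional (b - 2) (monicLaguerre b (n + 1) ^ 2) = a at *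
  generalize laguerreSqNorm b n = h at *
  generalize (n : ℝ) + 1 = N at *
  have hq : N * (N + b) * h / b * b = N * (N + b) * h := div_mul_cancel₀ _ hb0.ne'
  have e3 : N * (N + b) * h / b = N * (N + b) * (h / b) := by ring
  have e1 : 2 * a = (b + 2 * N + 1) * (2 * Q * h) := by
    linear_combination r1 - N * (N + b) * r3 - e3 - (b + 2 * N + 1) * r2
  refine mul_left_cancel₀ h0 ?_
  linear_combination (-b) * r1 + hq + (-b) * (b + 2 * N - 1) / 2 * e1

end MomentRecurrence

/-! ### The scaled moments as rational functions of 1/n² -/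

section DelayRatio

/-- The rational functions `R_k` with `n^{k-1} ⟨∑ xⱼ^{-k}⟩ = R_k(1/n²)`. -/
def delayRatio (w : ℝ) : ℕ → ℝ → ℝ
  -- This is n^(-1) ⟨n⟩. With this value the recursion at k = 0 gives the correct R_2, although the
  -- moment recurrence was not proved there.
  | 0 => fun _ => 1
  | 1 => fun _ => 1 / (w - 1)
  | k + 2 => fun y =>
      ((2 * k + 1) * (w + 1) * delayRatio w (k + 1) y + (1 - k) * delayRatio w k y) /
        ((k + 2) * ((w - 1) ^ 2 - (k + 1) ^ 2 * y))

theorem delayRatio_succ_succ (w : ℝ) (k : ℕ) (y : ℝ) : delayRatio w (k + 2) y =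
      ((2 * k + 1) * (w + 1) * delayRatio w (k + 1) y + (1 - k) * delayRatio w k y) /
        ((k + 2) * ((w - 1) ^ 2 - (k + 1) ^ 2 * y)) := rfl

theorem delayParam_two (w : ℝ) (n : ℕ) : delayParam 2 w n = n * (w - 1) := by
  rw [delayParam]; ring

theorem pow_mul_laguerreMoment {w : ℝ} (hw : 1 < w) {n : ℕ} (hn : 0 < n) :
    ∀ k : ℕ, (k : ℝ) < n * (w - 1) →
      (n : ℝ) ^ k * laguerreMoment (n * (w - 1)) (n * (w - 1) - (k + 1)) n =
        delayRatio w (k + 1) (1 / (n : ℝ) ^ 2)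
  | 0, h => by
    have h' : 0 < (n : ℝ) * (w - 1) := by simpa using h
    have hn' : (0 : ℝ) < n := by exact_mod_cast hn
    have hw' : w - 1 ≠ 0 := by linarith
    rw [Nat.cast_zero, zero_add, laguerreMoment_sub_one h', delayRatio]
    field_simp
  | 1, h => by
    rw [Nat.cast_one] at h
    have hn' : (0 : ℝ) < n := by exact_mod_cast hn
    have hw' : 0 < w - 1 := by linarith
    have h1 : (n * (w - 1)) ^ 2 - 1 ≠ 0 := by nlinarith
    have h2 : (w - 1) ^ 2 - 1 / (n : ℝ) ^ 2 ≠ 0 := by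
      intro h0
      apply h1
      have : (n * (w - 1)) ^ 2 - 1 = n ^ 2 * ((w - 1) ^ 2 - 1 / (n : ℝ) ^ 2) := by
        field_simp
      rw [this, h0, mul_zero]
    rw [Nat.cast_one, show (n : ℝ) * (w - 1) - (1 + 1) = n * (w - 1) - 2 by ring,
      laguerreMoment_sub_two h hn, delayRatio_succ_succ]
    simp only [delayRatio, Nat.cast_zero, mul_zero, zero_add, one_mul, one_pow, sub_zero, mul_one,
      pow_one]
    rw [mul_div_assoc', div_eq_div_iff (mul_ne_zero (mul_pos hn' hw').ne' h1)
      (mul_ne_zero two_ne_zero h2)]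
    field_simp
    ring
  | k + 2, h => by
    push_cast at h
    have hn' : (0 : ℝ) < n := by exact_mod_cast hn
    have hk : (0 : ℝ) ≤ k := k.cast_nonneg
    have ih0 := pow_mul_laguerreMoment hw hn k (by linarith)
    have ih1 := pow_mul_laguerreMoment hw hn (k + 1) (by push_cast; linarith)
    -- This s links the exponents b - (k + 1), b - (k + 2), b - (k + 3). The coefficient of the last
    -- contains b² - (k + 2)², nonzero since b > k + 2, and becomes the denominator of R_{k+3}.
    have hr := laguerreMoment_recurrence (b := n * (w - 1)) (s := -(k + 3)) (by linarith)
      (by linarith) (by linarith) (by linarith) hn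
    rw [delayRatio_succ_succ, ← ih0, ← ih1]
    have hd : ((w - 1) ^ 2 - (k + 2) ^ 2 * (1 / (n : ℝ) ^ 2)) * n ^ 2 =
        (n * (w - 1)) ^ 2 - (k + 2) ^ 2 := by field_simp
    have hd0 : (n * (w - 1)) ^ 2 - ((k : ℝ) + 2) ^ 2 ≠ 0 := by nlinarith
    have hd1 : (w - 1) ^ 2 - ((k : ℝ) + 2) ^ 2 * (1 / (n : ℝ) ^ 2) ≠ 0 := by
      intro h0; rw [h0, zero_mul] at hd; exact hd0 hd.symm
    push_cast
    rw [show (n : ℝ) * (w - 1) + -(k + 3) + 1 + 1 = n * (w - 1) - (k + 1) by ring,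
      show (n : ℝ) * (w - 1) + -(k + 3) + 1 = n * (w - 1) - (k + 1 + 1) by ring,
      show (n : ℝ) * (w - 1) + -(k + 3) = n * (w - 1) - (k + 2 + 1) by ring] at hr
    rw [show (k : ℝ) + 1 + 1 = k + 2 by ring] at hr ⊢
    rw [eq_div_iff (mul_ne_zero (by linarith) hd1)]
    linear_combination (k + 3) * n ^ k * laguerreMoment (n * (w - 1)) (n * (w - 1) - (k + 2 + 1)) n
      * hd - (n : ℝ) ^ k * hr

theorem scaledDelayMoment_eq_delayRatio {w : ℝ} (hw : 1 < w) {n k : ℕ} (hn : 0 < n)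
    (h : (k : ℝ) < n * (w - 1)) :
    scaledDelayMoment 2 w (k + 1) n = delayRatio w (k + 1) (1 / (n : ℝ) ^ 2) := by
  rw [scaledDelayMoment, delayParam_two, laguerreNegMoment_two (by push_cast; linarith) hn,
    ← pow_mul_laguerreMoment hw hn k h, Nat.add_sub_cancel]
  push_cast
  rfl

end DelayRatio

/-! ### Existence and uniqueness of asymptotic expansions -/

section Expansions

theorem tendsto_one_div_natCast : Tendsto (fun n : ℕ => 1 / (n : ℝ)) atTop (nhds 0) :=
  tendsto_one_div_atTop_nhds_zero_nat

/-- A function that is eventually `g (1 / n)` with `g` analytic at `0` has an asymptotic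
expansion in powers of `1 / n`. -/
theorem AnalyticAt.exists_hasAsymptoticExpansion {f : ℕ → ℝ} {g : ℝ → ℝ} (hg : AnalyticAt ℝ g 0)
    (h : ∀ᶠ n : ℕ in atTop, f n = g (1 / n)) : ∃ c, HasAsymptoticExpansion f c := by
  obtain ⟨p, hp⟩ := hg
  refine ⟨p.coeff, fun N => ?_⟩
  have hO := (hp.isBigO_sub_partialSum_pow N).comp_tendsto tendsto_one_div_natCast
  refine (hO.congr' ?_ ?_)
  · filter_upwards [h] with n hn
    simp only [Function.comp_apply, zero_add, hn, FormalMultilinearSeries.partialSum,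
      FormalMultilinearSeries.apply_eq_pow_smul_coeff, smul_eq_mul]
    congr 1
    refine Finset.sum_congr rfl fun i _ => ?_
    rw [div_pow, one_pow, one_div_mul_eq_div]
  · filter_upwards with n
    simp [Function.comp_apply]

/-- Uniqueness of the coefficients: the limit n → ∞ gives e 0 = 0; multiplying by n lowers the order
by one. -/
theorem eq_zero_of_sum_div_pow_isBigO (N : ℕ) : ∀ e : ℕ → ℝ,
    (fun n : ℕ => ∑ p ∈ Finset.range N, e p / (n : ℝ) ^ p) =O[atTop] (fun n : ℕ => 1 / (n : ℝ) ^ N) →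
    ∀ p < N, e p = 0 := by
  induction N with
  | zero => intro e _ p hp; omega
  | succ N ih =>
    intro e h
    have hs : ∀ n : ℕ, ∑ p ∈ Finset.range (N + 1), e p / (n : ℝ) ^ p =
        1 / (n : ℝ) * (∑ p ∈ Finset.range N, e (p + 1) / (n : ℝ) ^ p) + e 0 := by
      intro n
      rw [Finset.sum_range_succ', pow_zero, div_one, Finset.mul_sum]
      congr 1
      refine Finset.sum_congr rfl fun p _ => ?_
      rw [pow_succ', div_mul_div_comm, one_mul]
    have hlim : Tendsto (fun n : ℕ => ∑ p ∈ Finset.range (N + 1), e p / (n : ℝ) ^ p) atTop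
        (nhds (e 0)) := by
      have h2 : Tendsto (fun n : ℕ => ∑ p ∈ Finset.range (N + 1), e p * (1 / (n : ℝ)) ^ p) atTop
          (nhds (∑ p ∈ Finset.range (N + 1), e p * 0 ^ p)) :=
        tendsto_finsetSum _ fun p _ => (tendsto_one_div_natCast.pow p).const_mul _
      rw [Finset.sum_range_succ', Finset.sum_eq_zero (by intro p _; simp), zero_add, pow_zero,
        mul_one] at h2
      refine h2.congr fun n => Finset.sum_congr rfl fun p _ => ?_
      rw [div_pow, one_pow, mul_one_div]
    have h0 : Tendsto (fun n : ℕ => 1 / (n : ℝ) ^ (N + 1)) atTop (nhds 0) := by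
      have := tendsto_one_div_natCast.pow (N + 1)
      rw [zero_pow (Nat.succ_ne_zero N)] at this
      simpa only [div_pow, one_pow] using this
    have he0 : e 0 = 0 := tendsto_nhds_unique hlim (h.trans_tendsto h0)
    have hrest := ih (fun p => e (p + 1)) (by
      have hm := (isBigO_refl (fun n : ℕ => (n : ℝ)) atTop).mul h
      refine hm.congr' ?_ ?_
      · filter_upwards [eventually_gt_atTop 0] with n hn
        have hn' : (n : ℝ) ≠ 0 := by exact_mod_cast hn.ne'
        rw [hs, he0, add_zero, ← mul_assoc, mul_one_div_cancel hn', one_mul]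
      · filter_upwards [eventually_gt_atTop 0] with n hn
        have hn' : (n : ℝ) ≠ 0 := by exact_mod_cast hn.ne'
        rw [pow_succ]
        field_simp)
    intro p hp
    rcases p with _ | p
    · exact he0
    · exact hrest p (by omega)

/-- The Taylor polynomial of R of degree 1 in y = 1/n² has error O(n^(-4)), so it is an expansion to
order 3 with no 1/n term; uniqueness identifies the coefficients. -/
theorem HasAsymptoticExpansion.coeff_two_eq {f : ℕ → ℝ} {c : ℕ → ℝ}
    (hc : HasAsymptoticExpansion f c) {R : ℝ → ℝ} {d : ℝ} (hR : AnalyticAt ℝ R 0)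
    (hd : HasDerivAt R d 0) (h : ∀ᶠ n : ℕ in atTop, f n = R (1 / (n : ℝ) ^ 2)) : c 2 = d := by
  obtain ⟨p, hp⟩ := hR
  have hlim : Tendsto (fun n : ℕ => 1 / (n : ℝ) ^ 2) atTop (nhds 0) := by
    have := tendsto_one_div_natCast.pow 2
    rw [zero_pow two_ne_zero] at this
    simpa only [div_pow, one_pow] using this
  have hO := (hp.isBigO_sub_partialSum_pow 2).comp_tendsto hlim
  have hd' : p.coeff 1 = d := by
    have := hp.hasDerivAt.unique hd
    simpa using this
  let c' : ℕ → ℝ := fun i => if i = 0 then p.coeff 0 else if i = 2 then d else 0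
  have hO' : (fun n : ℕ => f n - ∑ i ∈ Finset.range 3, c' i / (n : ℝ) ^ i) =O[atTop]
      fun n : ℕ => 1 / (n : ℝ) ^ 3 := by
    have hO2 : (fun n : ℕ => f n - ∑ i ∈ Finset.range 3, c' i / (n : ℝ) ^ i) =O[atTop]
        fun n : ℕ => 1 / (n : ℝ) ^ 4 := by
      refine hO.congr' ?_ ?_
      · filter_upwards [h] with n hn
        simp only [Function.comp_apply, zero_add, hn, FormalMultilinearSeries.partialSum,
          FormalMultilinearSeries.apply_eq_pow_smul_coeff, smul_eq_mul, Finset.sum_range_succ,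
          Finset.sum_range_zero, hd', c']
        norm_num
        ring
      · filter_upwards with n
        simp only [Function.comp_apply, norm_div, norm_one, norm_pow, Real.norm_natCast, div_pow,
          one_pow, ← pow_mul]
    refine hO2.trans (IsBigO.of_bound 1 ?_)
    filter_upwards [eventually_ge_atTop 1] with n hn
    have hn' : (1 : ℝ) ≤ n := by exact_mod_cast hn
    rw [one_mul, Real.norm_of_nonneg (by positivity), Real.norm_of_nonneg (by positivity)]
    gcongr
    norm_num
  have hdiff := hO'.sub (hc 3)
  have := eq_zero_of_sum_div_pow_isBigO 3 (fun i => c i - c' i) (hdiff.congr_left fun n => by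
    simp only [sub_div, Finset.sum_sub_distrib]; ring) 2 (by norm_num)
  have h2 : c' 2 = d := by simp [c']
  linarith

end Expansions

/-! ### Values and derivatives of R_k at 0 through Gegenbauer polynomials -/

section DelayRatioCoefficients

/-- The Gegenbauer polynomials of parameter `5 / 2`, by their three-term recurrence. -/
def gegenbauerFiveHalves (x : ℝ) : ℕ → ℝ
  | 0 => 1
  | 1 => 5 * x
  | m + 2 => ((2 * m + 7) * x * gegenbauerFiveHalves x (m + 1) -
      (m + 5) * gegenbauerFiveHalves x m) / (m + 2)

/-- The Gegenbauer polynomials of parameter `3 / 2`, expressed by those of parameter `5 / 2`. -/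
def gegenbauerThreeHalves (x : ℝ) : ℕ → ℝ
  | 0 => 1
  | 1 => 3 * x
  | m + 2 => gegenbauerFiveHalves x (m + 2) - 2 * x * gegenbauerFiveHalves x (m + 1) +
      gegenbauerFiveHalves x m

theorem gegenbauerFiveHalves_recurrence (x : ℝ) (m : ℕ) :
    (m + 2) * gegenbauerFiveHalves x (m + 2) =
      (2 * m + 7) * x * gegenbauerFiveHalves x (m + 1) - (m + 5) * gegenbauerFiveHalves x m := by
  have : (m : ℝ) + 2 ≠ 0 := by positivity
  rw [gegenbauerFiveHalves, mul_div_cancel₀ _ this]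

/-- The definition is the coefficient form of q^(-3/2) = q · q^(-5/2) with q = 1 - 2xt + t². The
recurrence follows by combining three consecutive instances for parameter 5/2. -/
theorem gegenbauerThreeHalves_recurrence (x : ℝ) (m : ℕ) :
    (m + 2) * gegenbauerThreeHalves x (m + 2) =
      (2 * m + 5) * x * gegenbauerThreeHalves x (m + 1) - (m + 3) * gegenbauerThreeHalves x m := by
  rcases m with _ | _ | m
  · simp only [gegenbauerThreeHalves, gegenbauerFiveHalves]
    norm_num
    ring
  · simp only [gegenbauerThreeHalves, gegenbauerFiveHalves]
    norm_num
    ring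
  · have h2 := gegenbauerFiveHalves_recurrence x m
    have h3 := gegenbauerFiveHalves_recurrence x (m + 1)
    have h4 := gegenbauerFiveHalves_recurrence x (m + 2)
    simp only [gegenbauerThreeHalves]
    push_cast at *
    linear_combination h4 - 2 * x * h3 + h2

/-- The values `R_k(0)`. -/
def delayRatioZero (w : ℝ) : ℕ → ℝ
  | 0 => 1
  | 1 => 1 / (w - 1)
  | m + 2 => 2 * w * gegenbauerThreeHalves ((w + 1) / (w - 1)) m /
      ((m + 2) * (m + 1) * (w - 1) ^ (m + 3))

/-- The derivatives `R_k'(0)`. -/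
def delayRatioDeriv (w : ℝ) : ℕ → ℝ
  | 0 => 0
  | 1 => 0
  | m + 2 => w * gegenbauerFiveHalves ((w + 1) / (w - 1)) m / (w - 1) ^ (m + 5)

theorem analyticAt_delayRatio {w : ℝ} (hw : w - 1 ≠ 0) : ∀ k, AnalyticAt ℝ (delayRatio w k) 0
  | 0 => analyticAt_const
  | 1 => analyticAt_const
  | k + 2 => by
    have h0 := analyticAt_delayRatio hw k
    have h1 := analyticAt_delayRatio hw (k + 1)
    have hk : (k : ℝ) + 2 ≠ 0 := by positivity
    refine ((analyticAt_const.mul h1).add (analyticAt_const.mul h0)).div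
      (analyticAt_const.mul (analyticAt_const.sub (analyticAt_const.mul analyticAt_id))) ?_
    simpa using ⟨hk, hw⟩

theorem delayRatio_succ_succ_zero (w : ℝ) (k : ℕ) : delayRatio w (k + 2) 0 =
      ((2 * k + 1) * (w + 1) * delayRatio w (k + 1) 0 + (1 - k) * delayRatio w k 0) /
        ((k + 2) * (w - 1) ^ 2) := by
  rw [delayRatio_succ_succ, mul_zero, sub_zero]

/-- The y-dependence of the denominator produces the inhomogeneous term in R_{k+2}(0). -/
theorem hasDerivAt_delayRatio_succ_succ {w : ℝ} (hw : w - 1 ≠ 0) (k : ℕ) {d0 d1 : ℝ}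
    (h0 : HasDerivAt (delayRatio w k) d0 0) (h1 : HasDerivAt (delayRatio w (k + 1)) d1 0) :
    HasDerivAt (delayRatio w (k + 2)) (((2 * k + 1) * (w + 1) * d1 + (1 - k) * d0 +
      (k + 2) * (k + 1) ^ 2 * delayRatio w (k + 2) 0) / ((k + 2) * (w - 1) ^ 2)) 0 := by
  have hk : (k : ℝ) + 2 ≠ 0 := by positivity
  have hden : HasDerivAt (fun y : ℝ => (k + 2) * ((w - 1) ^ 2 - ((k : ℝ) + 1) ^ 2 * y))
      ((k + 2) * (-(((k : ℝ) + 1) ^ 2 * 1))) 0 :=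
    (((hasDerivAt_id (0 : ℝ)).const_mul _).const_sub _).const_mul _
  have h := ((h1.const_mul ((2 * (k : ℝ) + 1) * (w + 1))).add (h0.const_mul (1 - (k : ℝ)))).div
    hden (by simpa using ⟨hk, hw⟩)
  refine h.congr_deriv ?_
  rw [delayRatio_succ_succ_zero]
  simp only [Pi.add_apply, mul_zero, sub_zero]
  field_simp
  ring

theorem delayRatio_zero_and_hasDerivAt {w : ℝ} (hw : w - 1 ≠ 0) : ∀ k,
    delayRatio w k 0 = delayRatioZero w k ∧ HasDerivAt (delayRatio w k) (delayRatioDeriv w k) 0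
  | 0 => ⟨rfl, hasDerivAt_const _ _⟩
  | 1 => ⟨rfl, hasDerivAt_const _ _⟩
  | 2 => by
    have hv : delayRatio w 2 0 = delayRatioZero w 2 := by
      simp only [delayRatio, delayRatioZero, gegenbauerThreeHalves, Nat.cast_zero]
      field_simp
      ring
    refine ⟨hv, (hasDerivAt_delayRatio_succ_succ hw 0 (hasDerivAt_const _ _)
      (hasDerivAt_const _ _)).congr_deriv ?_⟩
    rw [hv]
    simp only [delayRatioZero, delayRatioDeriv, gegenbauerThreeHalves, gegenbauerFiveHalves,
      Nat.cast_zero]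
    field_simp
    ring
  -- Here the factor 1 - k of R_k vanishes, so R_1, which is outside the Gegenbauer pattern, drops
  -- out. From index 4 on both predecessors follow the pattern.
  | 3 => by
    obtain ⟨v2, d2⟩ := delayRatio_zero_and_hasDerivAt hw 2
    have hv : delayRatio w 3 0 = delayRatioZero w 3 := by
      rw [delayRatio_succ_succ_zero, v2]
      simp only [delayRatioZero, gegenbauerThreeHalves, Nat.cast_zero, Nat.cast_one]
      field_simp
      ring
    refine ⟨hv, (hasDerivAt_delayRatio_succ_succ hw 1 (hasDerivAt_const _ _) d2).congr_deriv ?_⟩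
    rw [hv]
    simp only [delayRatioZero, delayRatioDeriv, gegenbauerThreeHalves, gegenbauerFiveHalves,
      Nat.cast_one]
    field_simp
    ring
  | k + 4 => by
    obtain ⟨v2, d2⟩ := delayRatio_zero_and_hasDerivAt hw (k + 2)
    obtain ⟨v3, d3⟩ := delayRatio_zero_and_hasDerivAt hw (k + 3)
    have he := gegenbauerThreeHalves_recurrence ((w + 1) / (w - 1)) k
    have hf := gegenbauerFiveHalves_recurrence ((w + 1) / (w - 1)) k
    have hef : gegenbauerThreeHalves ((w + 1) / (w - 1)) (k + 2) =
        gegenbauerFiveHalves ((w + 1) / (w - 1)) (k + 2) -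
          2 * ((w + 1) / (w - 1)) * gegenbauerFiveHalves ((w + 1) / (w - 1)) (k + 1) +
          gegenbauerFiveHalves ((w + 1) / (w - 1)) k := rfl
    have hx : (w + 1) / (w - 1) * (w - 1) = w + 1 := div_mul_cancel₀ _ hw
    have hk2 : (k : ℝ) + 2 ≠ 0 := by positivity
    have hk1 : (k : ℝ) + 1 ≠ 0 := by positivity
    have hk3 : (k : ℝ) + 3 ≠ 0 := by positivity
    have hk4 : (k : ℝ) + 4 ≠ 0 := by positivity
    have hv : delayRatio w (k + 4) 0 = delayRatioZero w (k + 4) := by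
      rw [delayRatio_succ_succ_zero, v3, v2]
      simp only [delayRatioZero]
      rw [← hx]
      generalize (w + 1) / (w - 1) = x at he ⊢
      generalize w - 1 = v at hw ⊢
      push_cast
      rw [show (k : ℝ) + 2 + 2 = k + 4 by ring, show (k : ℝ) + 2 + 1 = k + 3 by ring,
        show (k : ℝ) + 1 + 2 = k + 3 by ring, show (k : ℝ) + 1 + 1 = k + 2 by ring]
      field_simp
      linear_combination (-(w * (k + 1) * v ^ (2 * k + 9))) * he
    refine ⟨hv, (hasDerivAt_delayRatio_succ_succ hw (k + 2) d2 d3).congr_deriv ?_⟩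
    rw [hv]
    simp only [delayRatioZero, delayRatioDeriv]
    rw [← hx]
    generalize (w + 1) / (w - 1) = x at hf hef ⊢
    generalize w - 1 = v at hw ⊢
    push_cast
    rw [show (k : ℝ) + 2 + 2 = k + 4 by ring, show (k : ℝ) + 2 + 1 = k + 3 by ring]
    field_simp
    -- The inhomogeneous term has parameter 3/2; `hef` rewrites it in parameter 5/2, and the
    -- recurrence `hf` remains.
    linear_combination w * v ^ (2 * k + 13) * (hf + 2 * (k + 3) * hef)

theorem eventually_scaledDelayMoment_eq {w : ℝ} (hw : 1 < w) {k : ℕ} (hk : 1 ≤ k) :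
    ∀ᶠ n : ℕ in atTop, scaledDelayMoment 2 w k n = delayRatio w k (1 / (n : ℝ) ^ 2) := by
  obtain ⟨k, rfl⟩ := Nat.exists_eq_add_of_le' hk
  have hlim : Tendsto (fun n : ℕ => (n : ℝ) * (w - 1)) atTop atTop :=
    tendsto_natCast_atTop_atTop.atTop_mul_const (by linarith)
  filter_upwards [eventually_gt_atTop 0, hlim.eventually_gt_atTop (k : ℝ)] with n hn h
  exact scaledDelayMoment_eq_delayRatio hw hn h

theorem exists_hasAsymptoticExpansion_scaledDelayMoment {w : ℝ} (hw : 1 < w) {k : ℕ} (hk : 1 ≤ k) :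
    ∃ c, HasAsymptoticExpansion (scaledDelayMoment 2 w k) c := by
  have ha : AnalyticAt ℝ (fun x : ℝ => delayRatio w k (x ^ 2)) 0 := by
    refine AnalyticAt.fun_comp (g := delayRatio w k) ?_ (by fun_prop)
    rw [zero_pow two_ne_zero]
    exact analyticAt_delayRatio (by linarith) k
  refine ha.exists_hasAsymptoticExpansion ?_
  filter_upwards [eventually_scaledDelayMoment_eq hw hk] with n hn
  rw [hn, div_pow, one_pow]

theorem coeff_two_scaledDelayMoment {w : ℝ} (hw : 1 < w) {k : ℕ} (hk : 1 ≤ k) {c : ℕ → ℝ}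
    (hc : HasAsymptoticExpansion (scaledDelayMoment 2 w k) c) : c 2 = delayRatioDeriv w k :=
  hc.coeff_two_eq (analyticAt_delayRatio (by linarith) k)
    (delayRatio_zero_and_hasDerivAt (by linarith) k).2 (eventually_scaledDelayMoment_eq hw hk)

end DelayRatioCoefficients

/-! ### Three-term recurrence of P^(2,2) and comparison with Gegenbauer polynomials -/

section Jacobi

open Polynomial

/-- The coefficients of the Jacobi polynomials `P_m^{(2,2)}` in powers of `(x - 1) / (x + 1)`. -/
def jacobiCoeff (m j : ℕ) : ℝ := ((m + 2).choose (j + 2) : ℝ) * ((m + 2).choose j : ℝ)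

/-- A sequence shifted by one place, with value `0` at the missing index. -/
def shiftSeq (a : ℕ → ℝ) : ℕ → ℝ
  | 0 => 0
  | j + 1 => a j

/-- The reciprocal Γ function is entire, and the convention that Γ and 0⁻¹ are 0 at the poles agrees
with it. Binomial identities can thus be checked without separating out-of-range indices. -/
theorem inv_Gamma_eq_mul_inv_Gamma_add_one (z : ℝ) :
    (Real.Gamma z)⁻¹ = z * (Real.Gamma (z + 1))⁻¹ := by
  rcases eq_or_ne z 0 with rfl | hz
  · simp
  · rw [Real.Gamma_add_one hz, mul_inv, mul_inv_cancel_left₀ hz]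

theorem inv_Gamma_neg_natCast (n : ℕ) : (Real.Gamma (-(n : ℝ)))⁻¹ = 0 := by
  rw [Real.Gamma_neg_nat_eq_zero, inv_zero]

theorem choose_eq_factorial_mul_inv_Gamma (n k : ℕ) : (n.choose k : ℝ) =
    n.factorial * (Real.Gamma (k + 1))⁻¹ * (Real.Gamma (n - k + 1))⁻¹ := by
  rcases le_or_gt k n with h | h
  · rw [Nat.cast_choose ℝ h, Real.Gamma_nat_eq_factorial, ← Nat.cast_sub h,
      Real.Gamma_nat_eq_factorial, div_mul_eq_div_div, div_eq_mul_inv, div_eq_mul_inv]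
  · obtain ⟨d, rfl⟩ := Nat.exists_eq_add_of_lt h
    rw [Nat.choose_eq_zero_of_lt h, show (n : ℝ) - ((n + d + 1 : ℕ) : ℝ) + 1 = -(d : ℝ) by
      push_cast; ring, inv_Gamma_neg_natCast]
    simp

theorem jacobiCoeff_eq (m j : ℕ) : jacobiCoeff m j = ((m + 2).factorial : ℝ) ^ 2 *
    ((Real.Gamma (j + 3))⁻¹ * (Real.Gamma (j + 1))⁻¹ *
      ((Real.Gamma (m - j + 1))⁻¹ * (Real.Gamma (m - j + 3))⁻¹)) := by
  rw [jacobiCoeff, choose_eq_factorial_mul_inv_Gamma, choose_eq_factorial_mul_inv_Gamma]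
  push_cast
  rw [show (j : ℝ) + 2 + 1 = j + 3 by ring, show (m : ℝ) + 2 - (j + 2) + 1 = m - j + 1 by ring,
    show (m : ℝ) + 2 - j + 1 = m - j + 3 by ring]
  ring

theorem shiftSeq_jacobiCoeff (m j : ℕ) : shiftSeq (jacobiCoeff m) j =
    ((m + 2).factorial : ℝ) ^ 2 * ((Real.Gamma (j + 2))⁻¹ * (Real.Gamma j)⁻¹ *
      ((Real.Gamma (m - j + 2))⁻¹ * (Real.Gamma (m - j + 4))⁻¹)) := by
  rcases j with _ | j
  · simp [shiftSeq]
  · rw [shiftSeq, jacobiCoeff_eq]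
    push_cast
    rw [show (j : ℝ) + 1 + 2 = j + 3 by ring, show (m : ℝ) - (j + 1) + 2 = m - j + 1 by ring,
      show (m : ℝ) - (j + 1) + 4 = m - j + 3 by ring]

theorem shiftSeq_shiftSeq_jacobiCoeff (m j : ℕ) : shiftSeq (shiftSeq (jacobiCoeff m)) j =
    ((m + 2).factorial : ℝ) ^ 2 * ((Real.Gamma (j + 1))⁻¹ * (Real.Gamma (j - 1))⁻¹ *
      ((Real.Gamma (m - j + 3))⁻¹ * (Real.Gamma (m - j + 5))⁻¹)) := by
  rcases j with _ | j
  · have := inv_Gamma_neg_natCast 1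
    rw [Nat.cast_one] at this
    simp [shiftSeq, this]
  · rw [shiftSeq, shiftSeq_jacobiCoeff]
    push_cast
    rw [show (j : ℝ) + 1 + 1 = j + 2 by ring, show (j : ℝ) + 1 - 1 = j by ring,
      show (m : ℝ) - (j + 1) + 3 = m - j + 2 by ring,
      show (m : ℝ) - (j + 1) + 5 = m - j + 4 by ring]

/-- With v = (x + 1)/2 and y = (x - 1)/(x + 1) one has x = v(1 + y) and 1 = v(1 - y), so the Jacobi
recurrence becomes homogeneous with multipliers 1 + y and (1 - y)²; these are the shift patterns
here. -/
theorem jacobiCoeff_recurrence (m j : ℕ) :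
    (m + 2) * (m + 6) * jacobiCoeff (m + 2) j =
      (2 * m + 7) * (m + 4) * (jacobiCoeff (m + 1) j + shiftSeq (jacobiCoeff (m + 1)) j) -
        (m + 3) * (m + 4) * (jacobiCoeff m j - 2 * shiftSeq (jacobiCoeff m) j +
          shiftSeq (shiftSeq (jacobiCoeff m)) j) := by
  have j2 := inv_Gamma_eq_mul_inv_Gamma_add_one ((j : ℝ) + 2)
  have j0 := inv_Gamma_eq_mul_inv_Gamma_add_one (j : ℝ)
  have jm := inv_Gamma_eq_mul_inv_Gamma_add_one ((j : ℝ) - 1)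
  have m1 := inv_Gamma_eq_mul_inv_Gamma_add_one ((m : ℝ) - j + 1)
  have m2 := inv_Gamma_eq_mul_inv_Gamma_add_one ((m : ℝ) - j + 2)
  have m3 := inv_Gamma_eq_mul_inv_Gamma_add_one ((m : ℝ) - j + 3)
  have m4 := inv_Gamma_eq_mul_inv_Gamma_add_one ((m : ℝ) - j + 4)
  have j1 := inv_Gamma_eq_mul_inv_Gamma_add_one ((j : ℝ) + 1)
  rw [jacobiCoeff_eq, jacobiCoeff_eq, jacobiCoeff_eq, shiftSeq_jacobiCoeff, shiftSeq_jacobiCoeff,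
    shiftSeq_shiftSeq_jacobiCoeff, Nat.factorial_succ (m + 1 + 2), Nat.factorial_succ (m + 2)]
  push_cast
  rw [show (m : ℝ) + 2 - j + 1 = m - j + 3 by ring, show (m : ℝ) + 2 - j + 3 = m - j + 5 by ring,
    show (m : ℝ) + 1 - j + 1 = m - j + 2 by ring, show (m : ℝ) + 1 - j + 3 = m - j + 4 by ring,
    show (m : ℝ) + 1 - j + 2 = m - j + 3 by ring, show (m : ℝ) + 1 - j + 4 = m - j + 5 by ring]
  rw [show (m : ℝ) - j + 1 + 1 = m - j + 2 by ring] at m1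
  rw [show (m : ℝ) - j + 2 + 1 = m - j + 3 by ring] at m2
  rw [show (m : ℝ) - j + 3 + 1 = m - j + 4 by ring] at m3
  rw [show (m : ℝ) - j + 4 + 1 = m - j + 5 by ring] at m4
  rw [show (j : ℝ) + 2 + 1 = j + 3 by ring] at j2
  rw [show (j : ℝ) - 1 + 1 = j by ring] at jm
  rw [m1, m2, jm, j0, j2, m4]
  have m35 : (Real.Gamma ((m : ℝ) - j + 3))⁻¹ =
      (m - j + 3) * ((m - j + 4) * (Real.Gamma ((m : ℝ) - j + 5))⁻¹) := by rw [m3, m4]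
  have j13 : (Real.Gamma ((j : ℝ) + 1))⁻¹ = (j + 1) * ((j + 2) * (Real.Gamma ((j : ℝ) + 3))⁻¹) := by
    rw [j1, show (j : ℝ) + 1 + 1 = j + 2 by ring, j2]
  generalize (Real.Gamma ((m : ℝ) - j + 5))⁻¹ = A at *
  generalize (Real.Gamma ((m : ℝ) - j + 3))⁻¹ = B at *
  generalize (Real.Gamma ((j : ℝ) + 3))⁻¹ = D at *
  generalize (Real.Gamma ((j : ℝ) + 1))⁻¹ = E at *
  generalize ((m + 2).factorial : ℝ) = F
  linear_combination (m + 3) * (m + 4) * F ^ 2 * D * E * (m - j + 1) * (m - j + 2) * B * m35 +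
    (m + 3) * (m + 4) * F ^ 2 * (j - 1) * j * E * B * A * j13

/-- The polynomial in `(x - 1) / (x + 1)` underlying `P_m^{(2,2)}`. -/
def jacobiPoly (m : ℕ) : ℝ[X] :=
  ∑ j ∈ Finset.range (m + 1), monomial j (jacobiCoeff m j)

theorem coeff_jacobiPoly (m j : ℕ) : (jacobiPoly m).coeff j = jacobiCoeff m j := by
  rw [jacobiPoly, finsetSum_coeff]
  simp only [coeff_monomial, Finset.sum_ite_eq', Finset.mem_range]
  split_ifs with h
  · rfl
  · rw [jacobiCoeff, Nat.choose_eq_zero_of_lt (by omega), Nat.cast_zero, zero_mul]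

theorem coeff_X_mul_eq_shiftSeq (p : ℝ[X]) : (X * p).coeff = shiftSeq p.coeff := by
  funext j
  rcases j with _ | j
  · rw [coeff_X_mul_zero, shiftSeq]
  · rw [coeff_X_mul, shiftSeq]

theorem jacobiPoly_recurrence (m : ℕ) :
    C ((m + 2 : ℝ) * (m + 6)) * jacobiPoly (m + 2) =
      C ((2 * m + 7 : ℝ) * (m + 4)) * (jacobiPoly (m + 1) + X * jacobiPoly (m + 1)) -
        C ((m + 3 : ℝ) * (m + 4)) * (jacobiPoly m - C 2 * (X * jacobiPoly m) +
          X * (X * jacobiPoly m)) := by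
  ext j
  have h : ∀ m, (jacobiPoly m).coeff = jacobiCoeff m := fun m => funext (coeff_jacobiPoly m)
  simp only [coeff_sub, coeff_add, coeff_C_mul, coeff_X_mul_eq_shiftSeq, h]
  exact jacobiCoeff_recurrence m j

theorem jacobiP_two_two_eq_eval {x : ℝ} (hx : x + 1 ≠ 0) (m : ℕ) :
    jacobiP 2 2 m x = ((x + 1) / 2) ^ m * (jacobiPoly m).eval ((x - 1) / (x + 1)) := by
  rw [jacobiP, jacobiPoly, eval_finsetSum, Finset.mul_sum]
  refine Finset.sum_congr rfl fun j hj => ?_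
  have hj' : j ≤ m := by rw [Finset.mem_range] at hj; omega
  obtain ⟨d, rfl⟩ := Nat.exists_eq_add_of_le hj'
  rw [eval_monomial, jacobiCoeff, ← Nat.choose_symm (show j + 2 ≤ j + d + 2 by omega),
    show j + d + 2 - (j + 2) = d by omega, Nat.add_sub_cancel_left, pow_add]
  rw [div_pow (x - 1) (x + 1), div_pow (x - 1), div_pow (x + 1) 2 j]
  field_simp

theorem jacobiP_two_two_recurrence {x : ℝ} (hx : x + 1 ≠ 0) (m : ℕ) :
    (m + 2) * (m + 6) * jacobiP 2 2 (m + 2) x =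
      (2 * m + 7) * (m + 4) * x * jacobiP 2 2 (m + 1) x -
        (m + 3) * (m + 4) * jacobiP 2 2 m x := by
  have h := congrArg (eval ((x - 1) / (x + 1))) (jacobiPoly_recurrence m)
  simp only [eval_sub, eval_add, eval_mul, eval_C, eval_X] at h
  rw [jacobiP_two_two_eq_eval hx, jacobiP_two_two_eq_eval hx, jacobiP_two_two_eq_eval hx]
  have hy : (x - 1) / (x + 1) * ((x + 1) / 2) = (x - 1) / 2 := by field_simp
  generalize (x - 1) / (x + 1) = y at *
  generalize eval y (jacobiPoly m) = A at *
  generalize eval y (jacobiPoly (m + 1)) = B at *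
  generalize eval y (jacobiPoly (m + 2)) = E at *
  have hxy : (x + 1) / 2 * (1 + y) = x := by linear_combination hy
  have hxy' : (x + 1) / 2 * (1 - y) = 1 := by linear_combination -hy
  rw [pow_add, pow_add, pow_one]
  generalize ((x + 1) / 2) ^ m = V
  generalize (x + 1) / 2 = v at *
  linear_combination V * v ^ 2 * h + (2 * m + 7) * (m + 4) * B * V * v * hxy -
    (m + 3) * (m + 4) * A * V * (v * (1 - y) + 1) * hxy'

/-- Both sides satisfy the same three-term recurrence with the same two initial values. -/
theorem gegenbauerFiveHalves_eq_jacobiP {x : ℝ} (hx : x + 1 ≠ 0) : ∀ m : ℕ,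
    12 * gegenbauerFiveHalves x m = (m + 3) * (m + 4) * jacobiP 2 2 m x
  | 0 => by simp [gegenbauerFiveHalves, jacobiP]; norm_num
  | 1 => by
    simp [gegenbauerFiveHalves, jacobiP, Finset.sum_range_succ]
    ring
  | m + 2 => by
    have h0 := gegenbauerFiveHalves_eq_jacobiP hx m
    have h1 := gegenbauerFiveHalves_eq_jacobiP hx (m + 1)
    have hf := gegenbauerFiveHalves_recurrence x m
    have hj := jacobiP_two_two_recurrence hx m
    have hm : (m : ℝ) + 2 ≠ 0 := by positivity
    refine mul_left_cancel₀ hm ?_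
    push_cast at h1 ⊢
    linear_combination 12 * hf + (2 * m + 7) * x * h1 - (m + 5) * h0 - (m + 5) * hj

end Jacobi

/-! ### Taylor series of q^(-5/2) -/

section GeneratingFunction

/-- The derivatives of a solution of `q h' + (5/2) q' h = 0`, where `q = s² - 2 a s + c`. -/
theorem iteratedDeriv_recurrence {h : ℂ → ℂ} {a c : ℂ} {U : Set ℂ} (hU : IsOpen U)
    (hh : DifferentiableOn ℂ h U)
    (hode : ∀ s ∈ U, (s ^ 2 - 2 * a * s + c) * deriv h s + 5 * (s - a) * h s = 0) (n : ℕ) :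
    ∀ s ∈ U, (s ^ 2 - 2 * a * s + c) * iteratedDeriv (n + 2) h s +
      (2 * n + 7) * (s - a) * iteratedDeriv (n + 1) h s +
      (n + 1) * (n + 5) * iteratedDeriv n h s = 0 := by
  have hd : ∀ k, ∀ s ∈ U, HasDerivAt (iteratedDeriv k h) (iteratedDeriv (k + 1) h s) s := by
    intro k s hs
    have hk : DifferentiableAt ℂ (iteratedDeriv k h) s := by
      have := (hh.analyticOnNhd hU).iterated_deriv k s hs
      rw [← iteratedDeriv_eq_iterate] at this
      exact this.differentiableAt
    rw [iteratedDeriv_succ]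
    exact hk.hasDerivAt
  have hq : ∀ s : ℂ, HasDerivAt (fun s : ℂ => s ^ 2 - 2 * a * s + c) (2 * (s - a)) s := by
    intro s
    refine ((((hasDerivAt_id s).pow 2).sub ((hasDerivAt_id s).const_mul (2 * a))).add_const
      c).congr_deriv ?_
    simp
    ring
  have hl : ∀ s : ℂ, HasDerivAt (fun s : ℂ => s - a) 1 s := fun s => (hasDerivAt_id s).sub_const a
  have hzero : ∀ {F : ℂ → ℂ} {F' s : ℂ}, s ∈ U → (∀ z ∈ U, F z = 0) → HasDerivAt F F' s → F' = 0 := by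
    intro F F' s hs hF hF'
    have : F =ᶠ[nhds s] fun _ => 0 := eventually_of_mem (hU.mem_nhds hs) hF
    exact hF'.unique ((hasDerivAt_const s (0 : ℂ)).congr_of_eventuallyEq this)
  induction n with
  | zero =>
    intro s hs
    have h0 := hd 0 s hs
    have h1 := hd 1 s hs
    have e := hzero hs (fun z hz => by
        simp only [Pi.add_apply, Pi.mul_apply, iteratedDeriv_one, iteratedDeriv_zero]
        exact hode z hz)
      (((hq s).mul h1).add (((hl s).const_mul 5).mul h0))
    simp only [Nat.cast_zero] at e ⊢
    linear_combination e
  | succ n ih =>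
    intro s hs
    -- Differentiating shifts the coefficients as required: (2n + 7) + 2 = 2(n + 1) + 7 and (n +
    -- 1)(n + 5) + (2n + 7) = (n + 2)(n + 6).
    have e := hzero hs ih ((((hq s).mul (hd (n + 2) s hs)).add
      (((hl s).const_mul (2 * (n : ℂ) + 7)).mul (hd (n + 1) s hs))).add
      ((hd n s hs).const_mul (((n : ℂ) + 1) * (n + 5))))
    push_cast
    linear_combination e

/-- The Taylor coefficients of a solution of `q h' + (5/2) q' h = 0`, where
`q = s² - 2 x v s + v²`. -/
theorem iteratedDeriv_eq_gegenbauerFiveHalves {h : ℂ → ℂ} {x v : ℝ} (hv : v ≠ 0) {U : Set ℂ}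
    (hU : IsOpen U) (h0 : (0 : ℂ) ∈ U) (hh : DifferentiableOn ℂ h U)
    (hode : ∀ s ∈ U, (s ^ 2 - 2 * (x * v : ℂ) * s + v ^ 2) * deriv h s +
      5 * (s - x * v) * h s = 0) :
    ∀ n : ℕ, v ^ n * iteratedDeriv n h 0 = n.factorial * gegenbauerFiveHalves x n * h 0
  | 0 => by simp [gegenbauerFiveHalves]
  | 1 => by
    have := hode 0 h0
    have hv' : (v : ℂ) ≠ 0 := by exact_mod_cast hv
    refine mul_left_cancel₀ hv' ?_
    simp only [gegenbauerFiveHalves, iteratedDeriv_one, Nat.factorial_one, Nat.cast_one]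
    push_cast
    linear_combination this
  | n + 2 => by
    have i0 := iteratedDeriv_eq_gegenbauerFiveHalves hv hU h0 hh hode n
    have i1 := iteratedDeriv_eq_gegenbauerFiveHalves hv hU h0 hh hode (n + 1)
    have hr := iteratedDeriv_recurrence hU hh hode n 0 h0
    have hf := congrArg (fun t : ℝ => (t : ℂ)) (gegenbauerFiveHalves_recurrence x n)
    rw [Nat.factorial_succ, Nat.factorial_succ]
    rw [Nat.factorial_succ] at i1
    push_cast at *
    linear_combination (v : ℂ) ^ n * hr + (2 * n + 7) * x * i1 - (n + 1) * (n + 5) * i0 -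
      (n + 1) * n.factorial * h 0 * hf

theorem hasSum_gegenbauerFiveHalves (x : ℝ) {v : ℝ} (hv : 0 < v) :
    ∃ ε : ℝ, 0 < ε ∧ ∀ s : ℂ, ‖s‖ < ε →
      HasSum (fun n : ℕ => (gegenbauerFiveHalves x n : ℂ) / v ^ (n + 5) * s ^ n)
        (1 / (s ^ 2 - 2 * (x * v : ℂ) * s + v ^ 2) ^ (5 / 2 : ℂ)) := by
  let q : ℂ → ℂ := fun s => s ^ 2 - 2 * (x * v : ℂ) * s + v ^ 2
  let h : ℂ → ℂ := fun s => 1 / q s ^ (5 / 2 : ℂ)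
  have hv' : (v : ℂ) ≠ 0 := by exact_mod_cast hv.ne'
  have hqc : Continuous q := by fun_prop
  have hq0 : q 0 = ((v ^ 2 : ℝ) : ℂ) := by simp [q]
  have hmem : q 0 ∈ Complex.slitPlane := by
    rw [hq0]; exact Complex.ofReal_mem_slitPlane.2 (by positivity)
  -- Since q(0) = v² > 0, q stays off the branch cut on some ball. There the principal power is
  -- holomorphic, so its Taylor series converges to it.
  obtain ⟨ε, hε, hball⟩ := Metric.isOpen_iff.1 (Complex.isOpen_slitPlane.preimage hqc) 0 hmem
  have hne : ∀ s ∈ Metric.ball (0 : ℂ) ε, q s ≠ 0 := fun s hs =>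
    Complex.slitPlane_ne_zero (hball hs)
  have hder : ∀ s ∈ Metric.ball (0 : ℂ) ε, HasDerivAt h
      (-(5 * (s - x * v)) / q s * h s) s := by
    intro s hs
    have hq : HasDerivAt q (2 * (s - x * v)) s := by
      refine ((((hasDerivAt_id s).pow 2).sub ((hasDerivAt_id s).const_mul
        (2 * (x * v : ℂ)))).add_const ((v : ℂ) ^ 2)).congr_deriv ?_
      simp
      ring
    have hp : q s ^ (5 / 2 : ℂ) ≠ 0 := by
      rw [Ne, Complex.cpow_eq_zero_iff]; exact fun hc => hne s hs hc.1
    have := (hasDerivAt_const s (1 : ℂ)).div (hq.cpow_const (c := (5 / 2 : ℂ)) (hball hs)) hp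
    refine this.congr_deriv ?_
    have hqs := hne s hs
    simp only [h]
    rw [Complex.cpow_sub _ _ hqs, Complex.cpow_one]
    field_simp
    ring
  have hdiff : DifferentiableOn ℂ h (Metric.ball 0 ε) := fun s hs =>
    (hder s hs).differentiableAt.differentiableWithinAt
  have hode : ∀ s ∈ Metric.ball (0 : ℂ) ε, (s ^ 2 - 2 * (x * v : ℂ) * s + v ^ 2) * deriv h s +
      5 * (s - x * v) * h s = 0 := by
    intro s hs
    rw [(hder s hs).deriv]
    change q s * (-(5 * (s - x * v)) / q s * h s) + _ = 0
    rw [← mul_assoc, mul_div_cancel₀ _ (hne s hs)]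
    ring
  have h0 : h 0 = 1 / (v : ℂ) ^ 5 := by
    have e : ((v ^ 2 : ℝ) : ℂ) ^ (5 / 2 : ℂ) = (v : ℂ) ^ 5 := by
      rw [show (5 / 2 : ℂ) = ((5 / 2 : ℝ) : ℂ) by push_cast; rfl,
        ← Complex.ofReal_cpow (by positivity), ← Real.rpow_natCast, ← Real.rpow_mul hv.le,
        show ((2 : ℕ) : ℝ) * (5 / 2) = ((5 : ℕ) : ℝ) by norm_num, Real.rpow_natCast]
      push_cast
      rfl
    simp only [h]
    rw [hq0, e]
  refine ⟨ε, hε, fun s hs => ?_⟩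
  have hs' : s ∈ Metric.ball (0 : ℂ) ε := by simpa using hs
  refine (Complex.hasSum_taylorSeries_on_ball hdiff hs').congr_fun ?_
  intro n
  have hn := iteratedDeriv_eq_gegenbauerFiveHalves hv.ne' Metric.isOpen_ball
    (Metric.mem_ball_self hε) hdiff hode n
  have hfac : (n.factorial : ℂ) ≠ 0 := by exact_mod_cast n.factorial_ne_zero
  rw [h0] at hn
  rw [sub_zero, smul_eq_mul, smul_eq_mul, pow_add]
  have e : iteratedDeriv n h 0 =
      n.factorial * gegenbauerFiveHalves x n * (1 / (v : ℂ) ^ 5) / v ^ n := by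
    rw [eq_div_iff (pow_ne_zero n hv'), mul_comm]; exact hn
  rw [e]
  field_simp

end GeneratingFunction

end

/-! ### The main theorem -/

theorem mainTheorem4 (w : ℝ) (hw : 1 < w) :
    -- the averages that define the moments are well defined
    (∀ k n : ℕ, 1 ≤ k → (k : ℝ) < n * (w - 1) + 1 →
      IntegrableOn (laguerreWeight 2 (delayParam 2 w n) n) (posOrthant n) ∧
      0 < laguerreNorm 2 (delayParam 2 w n) n ∧
      IntegrableOn (negMomentIntegrand 2 (delayParam 2 w n) k n) (posOrthant n)) ∧
    -- the moments have asymptotic expansions in powers of `1 / n`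
    (∃ D : ℕ → ℕ → ℝ, ∀ k : ℕ, 1 ≤ k →
      HasAsymptoticExpansion (scaledDelayMoment 2 w k) (D k)) ∧
    -- the third coefficient of the expansions, and its generating function
    (∀ D : ℕ → ℕ → ℝ,
      (∀ k : ℕ, 1 ≤ k → HasAsymptoticExpansion (scaledDelayMoment 2 w k) (D k)) →
      D 1 2 = 0 ∧
      (∀ k : ℕ, 2 ≤ k →
        D k 2 = ((k : ℝ) + 1) * ((k : ℝ) + 2) * w / (12 * (w - 1) ^ (k + 3)) *
          jacobiP 2 2 (k - 2) ((w + 1) / (w - 1))) ∧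
      ∃ ε : ℝ, 0 < ε ∧ ∀ s : ℂ, ‖s‖ < ε →
        HasSum (fun k : ℕ => (D (k + 1) 2 : ℂ) * s ^ (k + 1))
          ((w : ℂ) * s ^ 2 /
            (s ^ 2 - 2 * ((w : ℂ) + 1) * s + ((w : ℂ) - 1) ^ 2) ^ (5 / 2 : ℂ))) := by
  have hw1 : 0 < w - 1 := by linarith
  have hx : (w + 1) / (w - 1) * (w - 1) = w + 1 := div_mul_cancel₀ _ hw1.ne'
  refine ⟨fun k n hk hkn => ?_, ?_, fun D hD => ?_⟩
  · rw [delayParam_two]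
    have hk' : (1 : ℝ) ≤ k := by exact_mod_cast hk
    have hn : 0 < n := by
      rcases Nat.eq_zero_or_pos n with rfl | hn
      · rw [Nat.cast_zero, zero_mul] at hkn; linarith
      · exact hn
    have hb : (k : ℝ) - 1 < n * (w - 1) := by linarith
    have hb' : -1 < (n : ℝ) * (w - 1) := by linarith
    exact ⟨(laguerreNorm_two hb' hn).1, laguerreNorm_two_pos hb' hn,
      (integral_negMomentIntegrand hb n).1⟩
  · have h : ∀ k : ℕ, ∃ c, 1 ≤ k → HasAsymptoticExpansion (scaledDelayMoment 2 w k) c := by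
      intro k
      by_cases hk : 1 ≤ k
      · obtain ⟨c, hc⟩ := exists_hasAsymptoticExpansion_scaledDelayMoment hw hk
        exact ⟨c, fun _ => hc⟩
      · exact ⟨fun _ => 0, fun hk' => absurd hk' hk⟩
    choose D hD using h
    exact ⟨D, hD⟩
  · have hD2 : ∀ k, 1 ≤ k → D k 2 = delayRatioDeriv w k := fun k hk =>
      coeff_two_scaledDelayMoment hw hk (hD k hk)
    refine ⟨hD2 1 le_rfl, fun k hk => ?_, ?_⟩
    · obtain ⟨m, rfl⟩ := Nat.exists_eq_add_of_le' hk
      rw [hD2 _ (by omega), delayRatioDeriv, Nat.add_sub_cancel]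
      have hx1 : (w + 1) / (w - 1) + 1 ≠ 0 := by positivity
      have h := gegenbauerFiveHalves_eq_jacobiP hx1 m
      push_cast
      rw [show m + 2 + 3 = m + 5 from rfl, div_mul_eq_mul_div,
        div_eq_div_iff (by positivity) (by positivity)]
      linear_combination w * (w - 1) ^ (m + 5) * h
    · obtain ⟨ε, hε, h⟩ := hasSum_gegenbauerFiveHalves ((w + 1) / (w - 1)) hw1
      refine ⟨ε, hε, fun s hs => ?_⟩
      have hxc : (((w + 1) / (w - 1) : ℝ) : ℂ) * ((w - 1 : ℝ) : ℂ) = (w : ℂ) + 1 := by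
        rw [← Complex.ofReal_mul, hx]; push_cast; rfl
      have hsum := (h s hs).mul_left ((w : ℂ) * s ^ 2)
      rw [hxc, mul_one_div] at hsum
      -- The k = 1 term is zero and is split off. The rest starts at s², matching the series of
      -- q^(-5/2) multiplied by w s².
      rw [← hasSum_nat_add_iff' 1, Finset.sum_range_one, zero_add, hD2 1 le_rfl, delayRatioDeriv,
        Complex.ofReal_zero, zero_mul, sub_zero]
      push_cast at hsum
      refine hsum.congr_fun fun m => ?_
      rw [hD2 _ (by omega), delayRatioDeriv]
      push_cast
      ring
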